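/- Let $s$ be the Fréchet space of rapidly decreasing complex sequences $(x_i)_{i\ge 1}$, with the seminorms $\sup_i i^r|x_i|$, $r\in\mathbb N_0$, and let $s'$ be the space of slowly increasing complex sequences $(y_j)_{j\ge 1}$, i.e. $|y_j|\le C j^m$ for some $C$ and $m$, with the topology of the strong dual of $s$ under the pairing $\langle x,y\rangle=\sum_j x_jy_j$. For $1\le p\le\infty$ and $k\in\mathbb Z$ let $$(\ell^p)_{-k}=\{(y_j)_{j\ge1}\in\mathbb C^{\mathbb N} : (j^{-k}y_j)_j\in \ell^p\},\qquad \|y\|=\|(j^{-k}y_j)_j\|_{\ell^p},$$ and let $(c_0)_{-k}=\{(y_j)_{j\ge1} : j^{-k}y_j\to 0\}$ with the norm of $(\ell^\infty)_{-k}$. For locally convex spaces $E,F$ let $E\widehat\otimes F$ be the completion of $E\otimes F$ with respect to the projective topology (the finest locally convex topology for which $E\times F\to E\otimes F$ is continuous), and let $E\widehat\otimes_\iota F$ be the completion of $E\otimes F$ with respect to the inductive topology (the finest locally convex topology for which $E\times F\to E\otimes F$ is partially, i.e. separately, continuous). The inductive limits below are taken in the category of locally convex spaces as $k\to\infty$,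 along the maps $s\widehat\otimes(\ell^p)_{-k}\to s\widehat\otimes(\ell^p)_{-l}$ and $s\widehat\otimes(c_0)_{-k}\to s\widehat\otimes(c_0)_{-l}$, $k\le l$, induced by the inclusions. Then, for every $1\le p\le\infty$, there are isomorphisms of topological vector spaces $$s\widehat\otimes_\iota s'\;\cong\;\operatorname{ind\,lim}_k\bigl(s\widehat\otimes(\ell^p)_{-k}\bigr)\;\cong\;\operatorname{ind\,lim}_k\bigl(s\widehat\otimes(c_0)_{-k}\bigr),$$ and they are the canonical ones: they send an elementary tensor $x\otimes y$ to $x\otimes y$ whenever the sequence $y$ belongs to the spaces in question. -/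

import Mathlib

open scoped ENNReal TensorProduct Topology

noncomputable section

namespace SeqTensor

/-! ### Locally convex topologies on complex vector spaces -/

/-- `t` is a locally convex vector space topology on the complex vector space `E`. -/
structure IsLCTopology (E : Type*) [AddCommGroup E] [Module ℂ E] (t : TopologicalSpace E) :
    Prop where
  addGroup : @IsTopologicalAddGroup E t _
  smul : @ContinuousSMul ℂ E _ _ t
  convex : @LocallyConvexSpace ℝ E _ _ _ _ t

/-- The finest locally convex topology on `E` with the property `P`
(in Mathlib's order, `t ≤ t'` means that `t` is finer than `t'`). -/
@[reducible]
def finestLC (E : Type*) [AddCommGroup E] [Module ℂ E] (P : TopologicalSpace E → Prop) :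
    TopologicalSpace E :=
  sInf {t | IsLCTopology E t ∧ P t}

theorem isLCTopology_finestLC (E : Type*) [AddCommGroup E] [Module ℂ E]
    (P : TopologicalSpace E → Prop) : IsLCTopology E (finestLC E P) where
  addGroup := topologicalAddGroup_sInf fun _ ht => ht.1.addGroup
  smul := continuousSMul_sInf fun _ ht => ht.1.smul
  convex := LocallyConvexSpace.sInf fun _ ht => ht.1.convex

theorem IsLCTopology.induced {E F : Type*} [AddCommGroup E] [Module ℂ E] [AddCommGroup F]
    [Module ℂ F] {t : TopologicalSpace F} (ht : IsLCTopology F t) (f : E →ₗ[ℂ] F) :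
    IsLCTopology E (t.induced f) where
  addGroup := by
    let _ := t
    have := ht.addGroup
    exact topologicalAddGroup_induced f
  smul := by
    let _ := t
    have := ht.smul
    exact continuousSMul_induced f
  convex := by
    let _ := t
    have := ht.convex
    exact LocallyConvexSpace.induced (f.restrictScalars ℝ)

/-! ### The completed projective and inductive tensor products -/

section Tensor

variable (E F : Type*) [AddCommGroup E] [Module ℂ E] [TopologicalSpace E]
  [AddCommGroup F] [Module ℂ F] [TopologicalSpace F]

/-- The projective topology: the finest locally convex topology on `E ⊗ F` for which the
canonical bilinear map `E × F → E ⊗ F` is (jointly) continuous. -/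
@[reducible]
def projTopology : TopologicalSpace (E ⊗[ℂ] F) :=
  finestLC (E ⊗[ℂ] F) fun t =>
    @Continuous (E × F) (E ⊗[ℂ] F) _ t fun z => z.1 ⊗ₜ[ℂ] z.2

/-- The inductive topology: the finest locally convex topology on `E ⊗ F` for which the
canonical bilinear map `E × F → E ⊗ F` is partially (that is, separately) continuous. -/
@[reducible]
def indTopology : TopologicalSpace (E ⊗[ℂ] F) :=
  finestLC (E ⊗[ℂ] F) fun t =>
    (∀ x : E, @Continuous F (E ⊗[ℂ] F) _ t fun y => x ⊗ₜ[ℂ] y) ∧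
    (∀ y : F, @Continuous E (E ⊗[ℂ] F) _ t fun x => x ⊗ₜ[ℂ] y)

/-- `E ⊗ F` with the projective topology. -/
def ProjTensor : Type _ := E ⊗[ℂ] F

/-- `E ⊗ F` with the inductive topology. -/
def IndTensor : Type _ := E ⊗[ℂ] F

instance : AddCommGroup (ProjTensor E F) := inferInstanceAs (AddCommGroup (E ⊗[ℂ] F))
instance : Module ℂ (ProjTensor E F) := inferInstanceAs (Module ℂ (E ⊗[ℂ] F))
instance : AddCommGroup (IndTensor E F) := inferInstanceAs (AddCommGroup (E ⊗[ℂ] F))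
instance : Module ℂ (IndTensor E F) := inferInstanceAs (Module ℂ (E ⊗[ℂ] F))

/-- The uniform structure of the topological group `E ⊗ F`, for the projective topology. -/
instance : UniformSpace (ProjTensor E F) :=
  @IsTopologicalAddGroup.rightUniformSpace (E ⊗[ℂ] F) _ (projTopology E F)
    (isLCTopology_finestLC _ _).addGroup

/-- The uniform structure of the topological group `E ⊗ F`, for the inductive topology. -/
instance : UniformSpace (IndTensor E F) :=
  @IsTopologicalAddGroup.rightUniformSpace (E ⊗[ℂ] F) _ (indTopology E F)
    (isLCTopology_finestLC _ _).addGroup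

theorem isLCTopology_projTensor :
    IsLCTopology (ProjTensor E F) (inferInstance : TopologicalSpace (ProjTensor E F)) :=
  isLCTopology_finestLC (E ⊗[ℂ] F) _

theorem isLCTopology_indTensor :
    IsLCTopology (IndTensor E F) (inferInstance : TopologicalSpace (IndTensor E F)) :=
  isLCTopology_finestLC (E ⊗[ℂ] F) _

instance : IsTopologicalAddGroup (ProjTensor E F) := (isLCTopology_projTensor E F).addGroup
instance : ContinuousSMul ℂ (ProjTensor E F) := (isLCTopology_projTensor E F).smul
instance : IsTopologicalAddGroup (IndTensor E F) := (isLCTopology_indTensor E F).addGroup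
instance : ContinuousSMul ℂ (IndTensor E F) := (isLCTopology_indTensor E F).smul

instance : IsUniformAddGroup (ProjTensor E F) :=
  @isUniformAddGroup_of_addCommGroup (E ⊗[ℂ] F) _ (projTopology E F)
    (isLCTopology_finestLC _ _).addGroup
instance : IsUniformAddGroup (IndTensor E F) :=
  @isUniformAddGroup_of_addCommGroup (E ⊗[ℂ] F) _ (indTopology E F)
    (isLCTopology_finestLC _ _).addGroup

instance : UniformContinuousConstSMul ℂ (ProjTensor E F) :=
  uniformContinuousConstSMul_of_continuousConstSMul _ _
instance : UniformContinuousConstSMul ℂ (IndTensor E F) :=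
  uniformContinuousConstSMul_of_continuousConstSMul _ _

/-- The completed projective tensor product. -/
abbrev CompletedProj : Type _ := UniformSpace.Completion (ProjTensor E F)

/-- The completed inductive tensor product. -/
abbrev CompletedInd : Type _ := UniformSpace.Completion (IndTensor E F)

variable {E F}

/-- The elementary tensor `x ⊗ y` in the completed projective tensor product. -/
def CompletedProj.tmul (x : E) (y : F) : CompletedProj E F :=
  ((show ProjTensor E F from x ⊗ₜ[ℂ] y : ProjTensor E F) : UniformSpace.Completion (ProjTensor E F))

/-- The elementary tensor `x ⊗ y` in the completed inductive tensor product. -/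
def CompletedInd.tmul (x : E) (y : F) : CompletedInd E F :=
  ((show IndTensor E F from x ⊗ₜ[ℂ] y : IndTensor E F) : UniformSpace.Completion (IndTensor E F))

variable {G : Type*} [AddCommGroup G] [Module ℂ G] [TopologicalSpace G]

theorem continuous_projTopology_tmul :
    @Continuous (E × F) (E ⊗[ℂ] F) _ (projTopology E F) fun z => z.1 ⊗ₜ[ℂ] z.2 :=
  continuous_sInf_rng.2 fun _ ht => ht.2

theorem continuous_lTensor (u : F →L[ℂ] G) :
    @Continuous (E ⊗[ℂ] F) (E ⊗[ℂ] G) (projTopology E F) (projTopology E G)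
      (LinearMap.lTensor E u.toLinearMap) := by
  rw [continuous_iff_le_induced]
  refine sInf_le ⟨(isLCTopology_finestLC (E ⊗[ℂ] G) _).induced
    (LinearMap.lTensor E u.toLinearMap), ?_⟩
  let _ := projTopology E G
  refine continuous_induced_rng.2 ?_
  exact (continuous_projTopology_tmul (E := E) (F := G)).comp
    (continuous_fst.prodMk (u.continuous.comp continuous_snd))

variable (E) in
/-- The continuous linear map `id ⊗ u : E ⊗_π F → E ⊗_π G`. -/
def ProjTensor.lmap (u : F →L[ℂ] G) : ProjTensor E F →L[ℂ] ProjTensor E G where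
  toLinearMap := (LinearMap.lTensor E u.toLinearMap : E ⊗[ℂ] F →ₗ[ℂ] E ⊗[ℂ] G)
  cont := continuous_lTensor u

variable (E) in
/-- The continuous linear map `id ⊗ u : E ⊗̂_π F → E ⊗̂_π G` between the completions. -/
def CompletedProj.lmap (u : F →L[ℂ] G) : CompletedProj E F →L[ℂ] CompletedProj E G :=
  (ProjTensor.lmap E u).completion

end Tensor

/-! ### Inductive limits of locally convex spaces -/

section IndLim

variable {ι : Type*} [Preorder ι] [DecidableEq ι] (G : ι → Type*) [∀ i, AddCommGroup (G i)]
  [∀ i, Module ℂ (G i)] [∀ i, TopologicalSpace (G i)] (f : ∀ i j, i ≤ j → G i →L[ℂ] G j)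

/-- The locally convex inductive limit: the algebraic direct limit of the spaces `G i` along the
maps `f i j`, to be equipped with the locally convex inductive limit topology. -/
def IndLim : Type _ := Module.DirectLimit G fun i j h => (f i j h).toLinearMap

instance : AddCommGroup (IndLim G f) :=
  inferInstanceAs (AddCommGroup (Module.DirectLimit G fun i j h => (f i j h).toLinearMap))
instance : Module ℂ (IndLim G f) :=
  inferInstanceAs (Module ℂ (Module.DirectLimit G fun i j h => (f i j h).toLinearMap))

/-- The canonical map from the step `G i` to the inductive limit. -/
def IndLim.of (i : ι) : G i →ₗ[ℂ] IndLim G f :=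
  Module.DirectLimit.of ℂ ι G (fun i j h => (f i j h).toLinearMap) i

/-- The inductive limit topology: the finest locally convex topology for which all canonical maps
`G i → ind lim G` are continuous. -/
instance : TopologicalSpace (IndLim G f) :=
  finestLC (IndLim G f) fun t => ∀ i, @Continuous (G i) (IndLim G f) _ t (IndLim.of G f i)

end IndLim

/-! ### Rapidly decreasing and slowly increasing sequences -/

/-- The vector space of rapidly decreasing sequences. -/
def rapidSubmodule : Submodule ℂ (ℕ+ → ℂ) where
  carrier := {x | ∀ r : ℕ, BddAbove (Set.range fun j : ℕ+ => (j : ℝ) ^ r * ‖x j‖)}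
  zero_mem' r := ⟨0, by rintro _ ⟨j, rfl⟩; simp⟩
  add_mem' {x y} hx hy r := by
    obtain ⟨A, hA⟩ := hx r
    obtain ⟨B, hB⟩ := hy r
    refine ⟨A + B, ?_⟩
    rintro _ ⟨j, rfl⟩
    have h1 : (j : ℝ) ^ r * ‖x j‖ ≤ A := hA ⟨j, rfl⟩
    have h2 : (j : ℝ) ^ r * ‖y j‖ ≤ B := hB ⟨j, rfl⟩
    calc (j : ℝ) ^ r * ‖(x + y) j‖ ≤ (j : ℝ) ^ r * (‖x j‖ + ‖y j‖) := by
          gcongr; exact norm_add_le _ _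
      _ ≤ A + B := by rw [mul_add]; exact add_le_add h1 h2
  smul_mem' c x hx r := by
    obtain ⟨A, hA⟩ := hx r
    refine ⟨‖c‖ * A, ?_⟩
    rintro _ ⟨j, rfl⟩
    have h1 : (j : ℝ) ^ r * ‖x j‖ ≤ A := hA ⟨j, rfl⟩
    calc (j : ℝ) ^ r * ‖(c • x) j‖ = ‖c‖ * ((j : ℝ) ^ r * ‖x j‖) := by
          simp only [Pi.smul_apply, norm_smul]; ring
      _ ≤ ‖c‖ * A := by gcongr

/-- The space `s` of rapidly decreasing sequences `(x_j)`, `j = 1, 2, 3, …`. -/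
def RapidSeq : Type := rapidSubmodule

instance : AddCommGroup RapidSeq := inferInstanceAs (AddCommGroup rapidSubmodule)
instance : Module ℂ RapidSeq := inferInstanceAs (Module ℂ rapidSubmodule)

/-- The sequence underlying an element of `s`. -/
def RapidSeq.seq : RapidSeq →ₗ[ℂ] (ℕ+ → ℂ) := rapidSubmodule.subtype

theorem RapidSeq.bdd (x : RapidSeq) (r : ℕ) :
    BddAbove (Set.range fun j : ℕ+ => (j : ℝ) ^ r * ‖x.seq j‖) := x.2 r

/-- The seminorms `x ↦ sup_j j ^ r * |x_j|` of `s`. -/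
def rapidSeminorm : SeminormFamily ℂ RapidSeq ℕ := fun r =>
  Seminorm.of (fun x => ⨆ j : ℕ+, (j : ℝ) ^ r * ‖x.seq j‖)
    (fun x y => ciSup_le fun j => by
      calc (j : ℝ) ^ r * ‖(x + y).seq j‖
          ≤ (j : ℝ) ^ r * ‖x.seq j‖ + (j : ℝ) ^ r * ‖y.seq j‖ := by
            rw [map_add, ← mul_add]; gcongr; exact norm_add_le _ _
        _ ≤ _ := add_le_add (le_ciSup (x.bdd r) j) (le_ciSup (y.bdd r) j))
    (fun c x => by
      rw [Real.mul_iSup_of_nonneg (norm_nonneg c)]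
      refine iSup_congr fun j => ?_
      rw [map_smul, Pi.smul_apply, norm_smul]; ring)

/-- The Fréchet space topology of `s`. -/
instance : TopologicalSpace RapidSeq := rapidSeminorm.moduleFilterBasis.topology

theorem withSeminorms_rapidSeq : WithSeminorms rapidSeminorm := ⟨rfl⟩

instance : IsTopologicalAddGroup RapidSeq := withSeminorms_rapidSeq.topologicalAddGroup
instance : ContinuousSMul ℂ RapidSeq := withSeminorms_rapidSeq.continuousSMul

/-- The vector space of slowly increasing sequences. -/
def slowSubmodule : Submodule ℂ (ℕ+ → ℂ) where
  carrier := {y | ∃ (k : ℕ) (C : ℝ), ∀ j : ℕ+, ‖y j‖ ≤ C * (j : ℝ) ^ k}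
  zero_mem' := ⟨0, 0, by simp⟩
  add_mem' := by
    rintro x y ⟨k, A, hA⟩ ⟨l, B, hB⟩
    refine ⟨max k l, |A| + |B|, fun j => ?_⟩
    have hj : (1 : ℝ) ≤ j := by exact_mod_cast j.pos
    have h1 : ‖x j‖ ≤ |A| * (j : ℝ) ^ max k l := (hA j).trans
      (mul_le_mul (le_abs_self A) (pow_le_pow_right₀ hj (le_max_left k l)) (by positivity)
        (abs_nonneg A))
    have h2 : ‖y j‖ ≤ |B| * (j : ℝ) ^ max k l := (hB j).trans
      (mul_le_mul (le_abs_self B) (pow_le_pow_right₀ hj (le_max_right k l)) (by positivity)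
        (abs_nonneg B))
    calc ‖(x + y) j‖ ≤ ‖x j‖ + ‖y j‖ := norm_add_le _ _
      _ ≤ _ := by rw [add_mul]; exact add_le_add h1 h2
  smul_mem' := by
    rintro c x ⟨k, A, hA⟩
    refine ⟨k, ‖c‖ * A, fun j => ?_⟩
    rw [Pi.smul_apply, norm_smul, mul_assoc]
    exact mul_le_mul_of_nonneg_left (hA j) (norm_nonneg c)

/-- The space `s'` of slowly increasing sequences `(y_j)`, `j = 1, 2, 3, …`. -/
def SlowSeq : Type := slowSubmodule

instance : AddCommGroup SlowSeq := inferInstanceAs (AddCommGroup slowSubmodule)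
instance : Module ℂ SlowSeq := inferInstanceAs (Module ℂ slowSubmodule)

/-- The sequence underlying an element of `s'`. -/
def SlowSeq.seq : SlowSeq →ₗ[ℂ] (ℕ+ → ℂ) := slowSubmodule.subtype

theorem summable_inv_sq : Summable fun j : ℕ+ => ((j : ℝ) ^ 2)⁻¹ :=
  (Real.summable_nat_pow_inv.2 one_lt_two).comp_injective PNat.coe_injective

theorem norm_mul_le_of_slow {y : SlowSeq} {k : ℕ} {C : ℝ}
    (h : ∀ j : ℕ+, ‖y.seq j‖ ≤ C * (j : ℝ) ^ k) (x : RapidSeq) (j : ℕ+) :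
    ‖x.seq j * y.seq j‖ ≤ |C| * rapidSeminorm (k + 2) x * ((j : ℝ) ^ 2)⁻¹ := by
  have hj : (0 : ℝ) < j := by exact_mod_cast j.pos
  have h1 : (j : ℝ) ^ (k + 2) * ‖x.seq j‖ ≤ rapidSeminorm (k + 2) x :=
    le_ciSup (x.bdd (k + 2)) j
  have h2 : ‖y.seq j‖ ≤ |C| * (j : ℝ) ^ k :=
    (h j).trans (mul_le_mul_of_nonneg_right (le_abs_self C) (by positivity))
  rw [norm_mul, ← div_eq_mul_inv, le_div_iff₀ (by positivity)]
  calc ‖x.seq j‖ * ‖y.seq j‖ * (j : ℝ) ^ 2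
      ≤ ‖x.seq j‖ * (|C| * (j : ℝ) ^ k) * (j : ℝ) ^ 2 := by gcongr
    _ = |C| * ((j : ℝ) ^ (k + 2) * ‖x.seq j‖) := by ring
    _ ≤ |C| * rapidSeminorm (k + 2) x := by gcongr

theorem summable_pairing (x : RapidSeq) (y : SlowSeq) :
    Summable fun j : ℕ+ => x.seq j * y.seq j := by
  obtain ⟨k, C, h⟩ := y.2
  exact .of_norm_bounded (summable_inv_sq.mul_left _) (norm_mul_le_of_slow h x)

/-- The linear form `x ↦ ∑ x_j y_j` on `s` given by a slowly increasing sequence `y`. -/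
def SlowSeq.linForm (y : SlowSeq) : RapidSeq →ₗ[ℂ] ℂ where
  toFun x := ∑' j, x.seq j * y.seq j
  map_add' x z := by
    rw [← (summable_pairing x y).tsum_add (summable_pairing z y)]
    simp [add_mul]
  map_smul' c x := by
    rw [RingHom.id_apply, smul_eq_mul, ← tsum_mul_left]
    simp [mul_assoc]

theorem SlowSeq.continuous_linForm (y : SlowSeq) : Continuous y.linForm := by
  obtain ⟨k, C, h⟩ := id y.2
  refine withSeminorms_rapidSeq.continuous_normedSpace_rng ℂ y.linForm
    ⟨{k + 2}, ⟨|C| * ∑' j : ℕ+, ((j : ℝ) ^ 2)⁻¹, by positivity⟩, fun x => ?_⟩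
  have h1 := tsum_of_norm_bounded (summable_inv_sq.mul_left _).hasSum (norm_mul_le_of_slow h x)
  rw [tsum_mul_left] at h1
  refine h1.trans (le_of_eq ?_)
  rw [Finset.sup_singleton]
  change _ = |C| * (∑' j : ℕ+, ((j : ℝ) ^ 2)⁻¹) * rapidSeminorm (k + 2) x
  ring

/-- The continuous linear form `x ↦ ∑ x_j y_j` on `s` given by a slowly increasing sequence `y`. -/
def SlowSeq.form (y : SlowSeq) : StrongDual ℂ RapidSeq := ⟨y.linForm, y.continuous_linForm⟩

/-- The linear map from `s'` to the dual space of `s` given by this pairing. -/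
def SlowSeq.toDual : SlowSeq →ₗ[ℂ] StrongDual ℂ RapidSeq where
  toFun := SlowSeq.form
  map_add' y z := by
    ext x
    change ∑' j, x.seq j * (y + z).seq j = (∑' j, x.seq j * y.seq j) + ∑' j, x.seq j * z.seq j
    rw [← (summable_pairing x y).tsum_add (summable_pairing x z)]
    simp [mul_add]
  map_smul' c y := by
    ext x
    change ∑' j, x.seq j * (c • y).seq j = c * ∑' j, x.seq j * y.seq j
    rw [← tsum_mul_left]
    simp [mul_left_comm]

/-- The topology of `s'` as the strong dual of `s`: uniform convergence on the bounded subsets of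
`s`, which is the topology that Mathlib puts on `StrongDual ℂ s`. -/
instance : TopologicalSpace SlowSeq :=
  @TopologicalSpace.induced SlowSeq (StrongDual ℂ RapidSeq) SlowSeq.toDual inferInstance

/-! ### Weighted sequence spaces -/

/-- The vector space of all sequences `x` with `(j ^ (-k) * x_j) ∈ ℓ^p`. -/
def wlpSubmodule (p : ℝ≥0∞) (k : ℤ) : Submodule ℂ (ℕ+ → ℂ) where
  carrier := {x | Memℓp (fun j : ℕ+ => (j : ℂ) ^ (-k) * x j) p}
  zero_mem' := by
    have : Memℓp (0 : ℕ+ → ℂ) p := zero_memℓp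
    simpa [Pi.zero_def] using this
  add_mem' {x y} hx hy := by
    have := Memℓp.add hx hy
    simpa [mul_add, Pi.add_def] using this
  smul_mem' c x hx := by
    have := Memℓp.const_smul hx c
    simpa [Pi.smul_def, mul_left_comm] using this

/-- The space `(ℓ^p)_{-k} = j ^ k ℓ^p`. -/
def WLp (p : ℝ≥0∞) (k : ℤ) : Type := wlpSubmodule p k

section WLp

variable (p : ℝ≥0∞) (k : ℤ)

instance : AddCommGroup (WLp p k) := inferInstanceAs (AddCommGroup (wlpSubmodule p k))
instance : Module ℂ (WLp p k) := inferInstanceAs (Module ℂ (wlpSubmodule p k))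

variable {p k}

/-- The sequence underlying an element of `(ℓ^p)_{-k}`. -/
def WLp.seq : WLp p k →ₗ[ℂ] (ℕ+ → ℂ) := (wlpSubmodule p k).subtype

/-- Multiplication by the weight, `x ↦ (j ^ (-k) * x_j)`, as a map `(ℓ^p)_{-k} → ℓ^p`. -/
def WLp.toLp : WLp p k →ₗ[ℂ] lp (fun _ : ℕ+ => ℂ) p where
  toFun x := ⟨fun j : ℕ+ => (j : ℂ) ^ (-k) * x.seq j, x.2⟩
  map_add' x y := Subtype.ext (funext fun j => by
    change _ = (j : ℂ) ^ (-k) * x.seq j + (j : ℂ) ^ (-k) * y.seq j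
    simp [mul_add])
  map_smul' c x := Subtype.ext (funext fun j => by
    change _ = c * ((j : ℂ) ^ (-k) * x.seq j)
    simp [mul_left_comm])

theorem WLp.toLp_injective : Function.Injective (WLp.toLp (p := p) (k := k)) := by
  intro x y h
  refine Subtype.ext (funext fun j => ?_)
  have hj : ((j : ℂ) ^ (-k)) ≠ 0 := zpow_ne_zero _ (by exact_mod_cast j.ne_zero)
  exact mul_left_cancel₀ hj (congrFun (congrArg Subtype.val h) j)

variable [Fact (1 ≤ p)]

/-- The norm of `(ℓ^p)_{-k}` is `‖x‖ = ‖(j ^ (-k) * x_j)‖_p`. -/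
instance : NormedAddCommGroup (WLp p k) :=
  NormedAddCommGroup.induced (WLp p k) (lp (fun _ : ℕ+ => ℂ) p) WLp.toLp WLp.toLp_injective

instance : NormedSpace ℂ (WLp p k) :=
  NormedSpace.induced ℂ (WLp p k) (lp (fun _ : ℕ+ => ℂ) p) WLp.toLp

theorem WLp.norm_def (x : WLp p k) : ‖x‖ = ‖WLp.toLp x‖ := rfl

theorem norm_weight_mul_le {k l : ℤ} (h : k ≤ l) (z : ℂ) (j : ℕ+) :
    ‖(j : ℂ) ^ (-l) * z‖ ≤ ‖(j : ℂ) ^ (-k) * z‖ := by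
  have hj : (1 : ℝ) ≤ j := by exact_mod_cast j.pos
  simp only [norm_mul, norm_zpow, Complex.norm_natCast]
  gcongr

variable (p) in
/-- The inclusion `(ℓ^p)_{-k} ⊆ (ℓ^p)_{-l}` for `k ≤ l`, as a linear map. -/
def WLp.inclLinear {k l : ℤ} (h : k ≤ l) : WLp p k →ₗ[ℂ] WLp p l where
  toFun x := ⟨x.seq, Memℓp.mono' x.2 fun j => norm_weight_mul_le h (x.seq j) j⟩
  map_add' _ _ := rfl
  map_smul' _ _ := rfl

theorem WLp.norm_inclLinear_le {k l : ℤ} (h : k ≤ l) (x : WLp p k) :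
    ‖WLp.inclLinear p h x‖ ≤ 1 * ‖x‖ := by
  rw [one_mul, WLp.norm_def, WLp.norm_def]
  refine lp.norm_mono (zero_lt_one.trans_le (Fact.out : 1 ≤ p)).ne' fun j => ?_
  exact norm_weight_mul_le h (x.seq j) j

variable (p) in
/-- The continuous inclusion `(ℓ^p)_{-k} ⊆ (ℓ^p)_{-l}` for `k ≤ l`. -/
def WLp.incl {k l : ℤ} (h : k ≤ l) : WLp p k →L[ℂ] WLp p l :=
  (WLp.inclLinear p h).mkContinuous 1 (WLp.norm_inclLinear_le h)

end WLp

/-- The space `(c_0)_{-k} = j ^ k c_0` of all sequences `x` with `j ^ (-k) * x_j → 0`, as a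
subspace of `(ℓ^∞)_{-k}`, whose norm and topology it carries. -/
def WC0 (k : ℤ) : Submodule ℂ (WLp ∞ k) where
  carrier := {x | Filter.Tendsto (fun j : ℕ+ => (j : ℂ) ^ (-k) * x.seq j) Filter.atTop (𝓝 0)}
  zero_mem' := by simp
  add_mem' {x y} hx hy := by
    have := Filter.Tendsto.add hx hy
    simpa [mul_add] using this
  smul_mem' c x hx := by
    have := Filter.Tendsto.const_mul c hx
    simpa [mul_left_comm] using this

/-- The continuous inclusion `(c_0)_{-k} ⊆ (c_0)_{-l}` for `k ≤ l`. -/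
def WC0.incl {k l : ℤ} (h : k ≤ l) : WC0 k →L[ℂ] WC0 l :=
  ((WLp.incl ∞ h).comp (WC0 k).subtypeL).codRestrict (WC0 l) fun x =>
    squeeze_zero_norm (fun j => norm_weight_mul_le h (x.1.seq j) j)
      (tendsto_zero_iff_norm_tendsto_zero.1 x.2)

/-! ### The two inductive limits -/

/-- `ind lim_k (s ⊗̂ (ℓ^p)_{-k})`, over `k ∈ ℤ`. -/
abbrev LimLp (p : ℝ≥0∞) [Fact (1 ≤ p)] : Type :=
  IndLim (fun k : ℤ => CompletedProj RapidSeq (WLp p k))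
    fun _ _ h => CompletedProj.lmap RapidSeq (WLp.incl p h)

/-- `ind lim_k (s ⊗̂ (c_0)_{-k})`, over `k ∈ ℤ`. -/
abbrev LimC0 : Type :=
  IndLim (fun k : ℤ => CompletedProj RapidSeq (WC0 k))
    fun _ _ h => CompletedProj.lmap RapidSeq (WC0.incl h)

/-- The element `x ⊗ y` of `ind lim_k (s ⊗̂ (ℓ^p)_{-k})`, for `y ∈ (ℓ^p)_{-k}`. -/
def LimLp.tmul {p : ℝ≥0∞} [Fact (1 ≤ p)] {k : ℤ} (x : RapidSeq) (y : WLp p k) : LimLp p :=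
  IndLim.of (fun k : ℤ => CompletedProj RapidSeq (WLp p k))
    (fun _ _ h => CompletedProj.lmap RapidSeq (WLp.incl p h)) k (CompletedProj.tmul x y)

/-- The element `x ⊗ y` of `ind lim_k (s ⊗̂ (c_0)_{-k})`, for `y ∈ (c_0)_{-k}`. -/
def LimC0.tmul {k : ℤ} (x : RapidSeq) (y : WC0 k) : LimC0 :=
  IndLim.of (fun k : ℤ => CompletedProj RapidSeq (WC0 k))
    (fun _ _ h => CompletedProj.lmap RapidSeq (WC0.incl h)) k (CompletedProj.tmul x y)

end SeqTensor

end

/-! All the spaces are identified with one and the same space of matrices, `MatrixSpace`. An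
elementary tensor `x ⊗ y` always becomes the matrix `(x_i y_j)`, so that the resulting isomorphisms
are automatically the canonical ones.

A weight `w` is admitted if for every `k` there are `r` and `C` with `w_ij j^k ≤ C i^r`; the
topology is given by the seminorms `∑ w_ij |x_ij|`. These weights are exactly what continuous
seminorms look like on both sides. If `q` is a continuous seminorm on `s ⊗_ι s'`, then for fixed `x`
the numbers `q(x ⊗ e_j)` decrease rapidly, by the description of the strong topology of `s'`. Since
`s` is barrelled, the seminorms `j^k q(· ⊗ e_j)` are dominated, uniformly in `j`, by one continuous
seminorm of `s`; hence `w_ij = q(e_i ⊗ e_j)` is a weight (`exists_matrixWeight_of_seminorm`). The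
triangle inequality along `t = ∑ t_ij e_i ⊗ e_j` then bounds `q` by the seminorm of `w`, so that `s
⊗_ι s'` is a topological subspace of `MatrixSpace`. It is dense, and `MatrixSpace` is complete and
Hausdorff.

For the inductive limits, `s ⊗̂ F` is the space of rapidly decreasing sequences in the Banach space
`F` (`completedProjEquiv`). Of the spaces `(ℓ^p)_{-k}` and `(c_0)_{-k}` only little is used:
coordinates satisfy `|y_j| ≤ ‖y‖ j^k`, and `‖e_j‖ ≤ j^{-k}`. The limit is all of `MatrixSpace`
because every matrix in it satisfies `i^r |x_ij| ≤ C_r j^k` with `k` independent of `r`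
(`MatrixSpace.exists_bound`, a diagonal argument); two further powers of `j` make its rows converge
absolutely in a step. The inverse is continuous by the triangle inequality again: the values at the
unit matrices of a continuous seminorm on the limit form a weight. -/

open scoped NNReal

noncomputable section

namespace SeqTensor

open Filter Topology

/-! ### Seminorms on locally convex spaces -/

section Seminorms

variable {V X : Type*} [AddCommGroup V] [Module ℂ V] [TopologicalSpace V]
  [AddCommGroup X] [Module ℂ X] [TopologicalSpace X]

-- The nonnegative complex numbers are the nonnegative reals, so convexity over `ℂ` and over `ℝ`
-- agree. This makes all continuous seminorms available as a defining family for the tensor and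
-- limit topologies.
open scoped ComplexOrder in
theorem IsLCTopology.polynormableSpace
    (h : IsLCTopology V ‹TopologicalSpace V›) : PolynormableSpace ℂ V :=
  have := h.addGroup
  have := h.smul
  have := h.convex
  have : ContinuousSMul ℝ V := IsScalarTower.continuousSMul ℂ
  have : LocallyConvexSpace ℂ V := by
    refine (locallyConvexSpace_iff_zero ℂ V).2 ⟨fun U => ⟨fun hU => ?_, fun ⟨S, hS, hSU⟩ =>
      Filter.mem_of_superset hS.1 hSU⟩⟩
    obtain ⟨S, hS, hSU⟩ := (LocallyConvexSpace.convex_basis_zero ℝ V).mem_iff.1 hU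
    exact ⟨S, ⟨hS.1, convex_of_nonneg_surjective_algebraMap _
      (fun z hz => by
        obtain ⟨x, hx, rfl⟩ := RCLike.nonneg_iff_exists_ofReal.mp (Set.mem_Ici.1 hz)
        exact ⟨x, hx, rfl⟩) hS.2⟩, hSU⟩
  LocallyConvexSpace.toPolynormableSpace

theorem _root_.WithSeminorms.isLCTopology {ι : Type*} {p : SeminormFamily ℂ V ι}
    (hp : WithSeminorms p) : IsLCTopology V ‹TopologicalSpace V› where
  addGroup := hp.topologicalAddGroup
  smul := hp.continuousSMul
  convex := WithSeminorms.toLocallyConvexSpace hp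

theorem continuous_of_forall_seminorm_le [PolynormableSpace ℂ X] [IsTopologicalAddGroup V]
    (f : V →ₗ[ℂ] X)
    (h : ∀ q : Seminorm ℂ X, Continuous q →
      ∃ p : Seminorm ℂ V, Continuous p ∧ ∀ x, q (f x) ≤ p x) : Continuous f := by
  refine (PolynormableSpace.withSeminorms ℂ X).continuous_of_continuous_comp f fun q => ?_
  obtain ⟨p, hp, hle⟩ := h q.1 q.2
  exact Seminorm.continuous_of_le hp hle

/-- This reduces the two embedding statements, for `projToVec` and `indToMatrix`, to one estimate
per continuous seminorm of the domain. -/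
theorem isInducing_of_forall_seminorm_le [PolynormableSpace ℂ V] [IsTopologicalAddGroup V]
    [IsTopologicalAddGroup X] [ContinuousConstSMul ℂ X] (f : V →L[ℂ] X)
    (h : ∀ q : Seminorm ℂ V, Continuous q →
      ∃ p : Seminorm ℂ X, Continuous p ∧ ∀ x, q x ≤ p (f x)) : IsInducing f := by
  refine (IsTopologicalAddGroup.isInducing_iff_nhds_zero (f := f)).2
    (le_antisymm (tendsto_iff_comap.1 (map_zero f ▸ f.continuous.tendsto 0)) fun U hU => ?_)
  obtain ⟨s, r, hr, hs⟩ :=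
    ((PolynormableSpace.withSeminorms ℂ V).mem_nhds_iff 0 U).1 hU
  obtain ⟨p, hp, hle⟩ := h _ (Seminorm.continuous_finsetSup (s := s) fun i _ => i.2)
  refine ⟨p.ball 0 r, Seminorm.ball_mem_nhds hp hr, fun x hx => hs ?_⟩
  rw [Seminorm.mem_ball_zero]
  exact (hle x).trans_lt ((Seminorm.mem_ball_zero _).1 hx)

/-- The triangle inequality for convergent series; every domination of an abstract seminorm by a
concrete weighted one below comes from it. -/
theorem seminorm_le_tsum {A : Type*} {q : Seminorm ℂ V} (hq : Continuous q) {f : A → V} {x : V}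
    (hf : HasSum f x) {g : A → ℝ} (hg : Summable g) (h : ∀ a, q (f a) ≤ g a) :
    q x ≤ ∑' a, g a := by
  refine le_of_tendsto' ((hq.tendsto x).comp hf) fun s => ?_
  refine (Finset.le_sum_of_subadditive q (map_zero q).le (map_add_le_add q) s f).trans ?_
  refine (Finset.sum_le_sum fun a _ => h a).trans ?_
  exact hg.sum_le_tsum s fun a _ => (apply_nonneg q _).trans (h a)

end Seminorms

/-! ### Completions as closures of images -/

section Completion

variable {V X : Type*} [AddCommGroup V] [Module ℂ V] [UniformSpace V] [IsUniformAddGroup V]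
  [UniformContinuousConstSMul ℂ V] [AddCommGroup X] [Module ℂ X] [UniformSpace X]
  [IsUniformAddGroup X] [ContinuousConstSMul ℂ X] [CompleteSpace X] [T2Space X]

/-- A complete Hausdorff space containing the image of `V` under an inducing linear map as a
dense subspace is the completion of `V`. -/
def completionEquiv (f : V →L[ℂ] X) (hi : IsInducing f) (hd : DenseRange f) :
    UniformSpace.Completion V ≃L[ℂ] X :=
  let pkg : AbstractCompletion V :=
    { space := X
      coe := f
      uniformStruct := inferInstance
      complete := inferInstance
      separation := inferInstance
      isUniformInducing := AddMonoidHom.isUniformInducing_of_isInducing hi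
      dense := hd }
  let e : UniformSpace.Completion V ≃ᵤ X :=
    (UniformSpace.Completion.cPkg (α := V)).compareEquiv pkg
  have he : ∀ v : V, e v = f v := (UniformSpace.Completion.cPkg (α := V)).compare_coe pkg
  have hc : Continuous e := e.continuous
  { e with
    map_add' := fun x y => by
      refine UniformSpace.Completion.induction_on₂ x y
        (isClosed_eq (hc.comp (continuous_fst.add continuous_snd))
          ((hc.comp continuous_fst).add (hc.comp continuous_snd))) fun a b => ?_
      change e _ = e _ + e _
      rw [← UniformSpace.Completion.coe_add, he, he, he, map_add]
    map_smul' := fun c x => by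
      refine UniformSpace.Completion.induction_on x
        (isClosed_eq (hc.comp (continuous_const_smul c)) (hc.const_smul c)) fun a => ?_
      change e _ = c • e _
      rw [← UniformSpace.Completion.coe_smul, he, he, map_smul]
    continuous_toFun := hc
    continuous_invFun := e.symm.continuous }

theorem completionEquiv_coe (f : V →L[ℂ] X) (hi : IsInducing f) (hd : DenseRange f) (v : V) :
    completionEquiv f hi hd v = f v :=
  AbstractCompletion.compare_coe _ _ v

end Completion

/-! ### Weighted spaces of summable families -/

section Kothe

variable {ι A : Type*} (w : ι → A → ℝ≥0) (F : Type*) [NormedAddCommGroup F] [NormedSpace ℂ F]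

/-- The vector space of all families `x` with `∑ w_i(a) ‖x_a‖ < ∞` for all `i`. -/
def kotheSubmodule : Submodule ℂ (A → F) where
  carrier := {x | ∀ i, Summable fun a => (w i a : ℝ) * ‖x a‖}
  zero_mem' i := by simp [summable_zero]
  add_mem' {x y} hx hy i := by
    refine .of_nonneg_of_le (fun a => by positivity) (fun a => ?_) ((hx i).add (hy i))
    rw [← mul_add]
    exact mul_le_mul_of_nonneg_left (norm_add_le _ _) (by positivity)
  smul_mem' c x hx i := by
    refine ((hx i).mul_left ‖c‖).congr fun a => ?_
    rw [Pi.smul_apply, norm_smul]; ring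

/-- The Köthe space of all families `x` with `∑ w_i(a) ‖x_a‖ < ∞` for all `i`. -/
def Kothe : Type _ := kotheSubmodule w F

instance : AddCommGroup (Kothe w F) := inferInstanceAs (AddCommGroup (kotheSubmodule w F))
instance : Module ℂ (Kothe w F) := inferInstanceAs (Module ℂ (kotheSubmodule w F))

namespace Kothe

variable {w F}

/-- The family underlying an element of a Köthe space. -/
def val : Kothe w F →ₗ[ℂ] (A → F) := (kotheSubmodule w F).subtype

/-- The element of a Köthe space given by a family. -/
def mk (x : A → F) (hx : ∀ i, Summable fun a => (w i a : ℝ) * ‖x a‖) : Kothe w F := ⟨x, hx⟩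

@[simp] theorem val_mk (x : A → F) (hx : ∀ i, Summable fun a => (w i a : ℝ) * ‖x a‖) :
    (mk x hx).val = x := rfl

theorem val_injective : Function.Injective (val (w := w) (F := F)) := Subtype.val_injective

theorem summable (x : Kothe w F) (i : ι) : Summable fun a => (w i a : ℝ) * ‖x.val a‖ := x.2 i

variable (w F) in
/-- The seminorms `x ↦ ∑ w_i(a) ‖x_a‖`. -/
def seminorm : SeminormFamily ℂ (Kothe w F) ι := fun i =>
  Seminorm.of (fun x => ∑' a, (w i a : ℝ) * ‖x.val a‖)
    (fun x y => by
      rw [← (x.summable i).tsum_add (y.summable i)]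
      refine (summable _ i).tsum_le_tsum (fun a => ?_) ((x.summable i).add (y.summable i))
      rw [← mul_add, map_add]
      exact mul_le_mul_of_nonneg_left (norm_add_le _ _) (by positivity))
    (fun c x => by
      rw [← tsum_mul_left]
      refine tsum_congr fun a => ?_
      rw [map_smul, Pi.smul_apply, norm_smul]; ring)

theorem seminorm_apply (i : ι) (x : Kothe w F) :
    seminorm w F i x = ∑' a, (w i a : ℝ) * ‖x.val a‖ := rfl

theorem le_seminorm (i : ι) (x : Kothe w F) (a : A) :
    (w i a : ℝ) * ‖x.val a‖ ≤ seminorm w F i x :=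
  (x.summable i).le_tsum a fun _ _ => by positivity

instance : TopologicalSpace (Kothe w F) := (seminorm w F).moduleFilterBasis.topology

theorem withSeminorms : WithSeminorms (seminorm w F) := ⟨rfl⟩

instance : IsTopologicalAddGroup (Kothe w F) := withSeminorms.topologicalAddGroup
instance : ContinuousSMul ℂ (Kothe w F) := withSeminorms.continuousSMul

instance : PolynormableSpace ℂ (Kothe w F) := withSeminorms.toPolynormableSpace

theorem continuous_seminorm (i : ι) : Continuous (seminorm w F i) :=
  withSeminorms.continuous_seminorm i

/-- In general finitely many weights are needed to bound `q`; directedness replaces them by a single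
one. -/
theorem exists_bound_of_directed [Nonempty ι] (hw : ∀ i j, ∃ k, ∀ a, w i a ≤ w k a ∧ w j a ≤ w k a)
    {q : Seminorm ℂ (Kothe w F)} (hq : Continuous q) :
    ∃ (i : ι) (C : ℝ), 0 ≤ C ∧ ∀ x, q x ≤ C * seminorm w F i x := by
  classical
  have mono : ∀ i k, (∀ a, w i a ≤ w k a) → seminorm w F i ≤ seminorm w F k := by
    intro i k h x
    refine (x.summable i).tsum_le_tsum (fun a => ?_) (x.summable k)
    exact mul_le_mul_of_nonneg_right (by exact_mod_cast h a) (norm_nonneg _)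
  obtain ⟨s, C, -, hC⟩ := Seminorm.bound_of_continuous withSeminorms q hq
  have key : ∀ s : Finset ι, ∃ k, s.sup (seminorm w F) ≤ seminorm w F k := by
    intro s
    induction s using Finset.induction_on with
    | empty => exact ⟨Classical.arbitrary ι, by simp⟩
    | insert i s _ ih =>
      obtain ⟨j, hj⟩ := ih
      obtain ⟨k, hk⟩ := hw i j
      refine ⟨k, ?_⟩
      rw [Finset.sup_insert]
      exact sup_le (mono i k fun a => (hk a).1) (hj.trans (mono j k fun a => (hk a).2))
  obtain ⟨k, hk⟩ := key s
  refine ⟨k, C, C.2, fun x => (hC x).trans ?_⟩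
  exact mul_le_mul_of_nonneg_left (hk x) C.2

/-- The coordinate maps of a Köthe space. -/
def coord (hw : ∀ a, ∃ i, w i a ≠ 0) (a : A) : Kothe w F →L[ℂ] F where
  toLinearMap := (LinearMap.proj a).comp val
  cont := by
    obtain ⟨i, hi⟩ := hw a
    have hi' : (0 : ℝ) < w i a := by exact_mod_cast pos_iff_ne_zero.2 hi
    refine withSeminorms.continuous_normedSpace_rng F _ ⟨{i}, (w i a)⁻¹, fun x => ?_⟩
    rw [Finset.sup_singleton]
    change ‖x.val a‖ ≤ ((w i a)⁻¹ : ℝ≥0) * seminorm w F i x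
    rw [NNReal.coe_inv, ← div_eq_inv_mul, le_div_iff₀ hi', mul_comm]
    exact le_seminorm i x a

theorem t2Space (hw : ∀ a, ∃ i, w i a ≠ 0) : T2Space (Kothe w F) := by
  refine T2Space.of_injective_continuous (Y := A → F) (f := val) val_injective
    (continuous_pi fun a => (coord hw a).continuous)

section Single

variable [DecidableEq A]

/-- The family whose only nonzero term is `f`, at the index `a`. -/
def single (a : A) : F →ₗ[ℂ] Kothe w F where
  toFun f := mk (Pi.single a f) fun i => by
    refine summable_of_ne_finset_zero (s := {a}) fun b hb => ?_
    rw [Pi.single_eq_of_ne (by simpa using hb), norm_zero, mul_zero]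
  map_add' f g := val_injective (Pi.single_add (f := fun _ => F) a f g)
  map_smul' c f := val_injective (Pi.single_smul (f := fun _ => F) a c f)

@[simp] theorem val_single (a : A) (f : F) : (single a f : Kothe w F).val = Pi.single a f := rfl

theorem seminorm_single (i : ι) (a : A) (f : F) :
    seminorm w F i (single a f) = w i a * ‖f‖ := by
  rw [seminorm_apply, tsum_eq_single a fun b hb => ?_]
  · simp
  · simp [hb]

/-- In each seminorm the error of the partial sum over `s` is the sum of `w_i(a) ‖x_a‖` over the
complement of `s`, which tends to zero. -/
theorem hasSum_single (x : Kothe w F) : HasSum (fun a => single a (x.val a)) x := by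
  refine (withSeminorms.tendsto_nhds _ x).2 fun i ε hε => ?_
  have h := tendsto_tsum_compl_atTop_zero fun a => (w i a : ℝ) * ‖x.val a‖
  filter_upwards [(tendsto_order.1 h).2 ε hε] with s hs
  refine lt_of_eq_of_lt ?_ hs
  have hval : ∀ a, (∑ b ∈ s, single b (x.val b) - x : Kothe w F).val a =
      if a ∈ s then 0 else -x.val a := by
    intro a
    rw [map_sub, map_sum, Pi.sub_apply, Finset.sum_apply]
    simp only [val_single, Pi.single_apply, Finset.sum_ite_eq]
    split_ifs <;> simp
  have := tsum_subtype (s := {a | a ∉ s}) (f := fun a => (w i a : ℝ) * ‖x.val a‖)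
  refine Eq.trans ?_ this.symm
  refine tsum_congr fun a => ?_
  rw [hval, Set.indicator_apply]
  by_cases ha : a ∈ s <;> simp [ha]

end Single

instance : UniformSpace (Kothe w F) := IsTopologicalAddGroup.rightUniformSpace _
instance : IsUniformAddGroup (Kothe w F) := isUniformAddGroup_of_addCommGroup

/-- A Cauchy filter converges in every coordinate. The Cauchy estimate holds for finite partial
sums, passes to the coordinatewise limit, and is uniform in the finite set; so it holds for the full
sums, which gives both membership of the limit and convergence to it. -/
theorem completeSpace [CompleteSpace F] (hw : ∀ a, ∃ i, w i a ≠ 0) :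
    CompleteSpace (Kothe w F) := by
  refine ⟨fun {f} hf => ?_⟩
  have := hf.1
  have hpt : ∀ a, ∃ y, Tendsto (fun x : Kothe w F => x.val a) f (𝓝 y) := fun a =>
    CompleteSpace.complete (hf.map (coord hw a).uniformContinuous)
  choose x hx using hpt
  have key : ∀ i, ∀ ε > 0, ∀ᶠ y in f, Summable (fun a => (w i a : ℝ) * ‖y.val a - x a‖) ∧
      ∑' a, (w i a : ℝ) * ‖y.val a - x a‖ ≤ ε := by
    intro i ε hε
    have hU : {z : Kothe w F × Kothe w F | seminorm w F i (z.2 - z.1) < ε} ∈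
        uniformity (Kothe w F) := by
      rw [uniformity_eq_comap_nhds_zero]
      refine ⟨(seminorm w F i).ball 0 ε,
        Seminorm.ball_mem_nhds (continuous_seminorm i) hε, fun z hz => ?_⟩
      simpa using hz
    obtain ⟨t, ht, htU⟩ := (cauchy_iff.1 hf).2 _ hU
    filter_upwards [ht] with y hy
    have hb : ∀ s : Finset A, ∑ a ∈ s, (w i a : ℝ) * ‖y.val a - x a‖ ≤ ε := by
      intro s
      have hlim : Tendsto (fun z : Kothe w F => ∑ a ∈ s, (w i a : ℝ) * ‖y.val a - z.val a‖) f
          (𝓝 (∑ a ∈ s, (w i a : ℝ) * ‖y.val a - x a‖)) :=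
        tendsto_finsetSum _ fun a _ => ((tendsto_const_nhds.sub (hx a)).norm).const_mul _
      refine le_of_tendsto hlim ?_
      filter_upwards [ht] with z hz
      have h1 : seminorm w F i (y - z) < ε := htU (Set.mk_mem_prod hz hy)
      refine le_trans ?_ h1.le
      have h2 := (y - z).summable i
      rw [map_sub] at h2
      rw [seminorm_apply, map_sub]
      exact h2.sum_le_tsum s fun _ _ => by positivity
    exact ⟨summable_of_sum_le (fun _ => by positivity) hb,
      Real.tsum_le_of_sum_le (fun _ => by positivity) hb⟩
  have hmem : ∀ i, Summable fun a => (w i a : ℝ) * ‖x a‖ := by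
    intro i
    obtain ⟨y, hy, -⟩ := (key i 1 one_pos).exists
    refine .of_nonneg_of_le (fun a => by positivity) (fun a => ?_) ((y.summable i).add hy)
    rw [← mul_add]
    refine mul_le_mul_of_nonneg_left ?_ (by positivity)
    calc ‖x a‖ = ‖y.val a - (y.val a - x a)‖ := by rw [sub_sub_cancel]
      _ ≤ _ := norm_sub_le _ _
  refine ⟨mk x hmem, (withSeminorms.tendsto_nhds (u := id) (mk x hmem)).2 fun i ε hε => ?_⟩
  filter_upwards [key i (ε / 2) (half_pos hε)] with y hy
  refine lt_of_le_of_lt ?_ (half_lt_self hε)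
  rw [seminorm_apply, id, map_sub]
  exact hy.2

end Kothe

end Kothe

/-! ### The space of matrices that decrease rapidly in one index and grow slowly in the other -/

/-- The nonnegative matrices that grow slowly in the first index, relative to a rapid decrease of
arbitrary order in the second one. -/
def MatrixWeight : Type :=
  {w : ℕ+ × ℕ+ → ℝ≥0 // ∀ k : ℕ, ∃ (r : ℕ) (C : ℝ), ∀ i j : ℕ+,
    (w (i, j) : ℝ) * (j : ℝ) ^ k ≤ C * (i : ℝ) ^ r}

/-- The space of all matrices summable against all elements of `MatrixWeight`. -/
abbrev MatrixSpace : Type := Kothe (fun w : MatrixWeight => w.1) ℂ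

theorem one_le_pnat_cast (j : ℕ+) : (1 : ℝ) ≤ j := by exact_mod_cast j.pos

/-- The hypothesis says that `|x|⁻¹` on `S`, extended by zero, is an admissible weight. Against it
the matrix `x` has the terms 1 on `S`, and these are summable. -/
theorem MatrixSpace.finite_of_bound (x : MatrixSpace) {S : Set (ℕ+ × ℕ+)}
    (hS : ∀ k : ℕ, ∃ (r : ℕ) (C : ℝ), ∀ a ∈ S, (a.2 : ℝ) ^ k ≤ C * (a.1 : ℝ) ^ r * ‖x.val a‖) :
    S.Finite := by
  classical
  -- The case `k = 0` of the hypothesis excludes zero entries on `S`.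
  have h0 : ∀ a ∈ S, 0 < ‖x.val a‖ := by
    intro a ha
    obtain ⟨r, C, h⟩ := hS 0
    have h1 := h a ha
    rw [pow_zero] at h1
    refine (norm_nonneg _).lt_of_ne fun h2 => ?_
    rw [← h2, mul_zero] at h1
    linarith
  let w : MatrixWeight := ⟨fun a => if a ∈ S then ‖x.val a‖₊⁻¹ else 0, fun k => by
    obtain ⟨r, C, h⟩ := hS k
    refine ⟨r, |C|, fun i j => ?_⟩
    beta_reduce
    split_ifs with ha
    · have h2 := h0 _ ha
      rw [NNReal.coe_inv, coe_nnnorm, ← div_eq_inv_mul, div_le_iff₀ h2]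
      refine (h _ ha).trans ?_
      gcongr
      exact le_abs_self C
    · rw [NNReal.coe_zero, zero_mul]; positivity⟩
  have hs := (x.summable w).tendsto_cofinite_zero
  have h1 := (tendsto_order.1 hs).2 1 one_pos
  refine (Filter.eventually_cofinite.1 h1).subset fun a ha => ?_
  have : (w.1 a : ℝ) * ‖x.val a‖ = 1 := by
    change ((if a ∈ S then ‖x.val a‖₊⁻¹ else 0 : ℝ≥0) : ℝ) * ‖x.val a‖ = 1
    rw [if_pos ha, NNReal.coe_inv, coe_nnnorm, inv_mul_cancel₀ (h0 a ha).ne']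
  simp [this]

/-- Otherwise every `k` has an exponent `r k` for which `i^(r k) |x_ij| / j^k` is unbounded, so the
set `A k` where this ratio is at least 1 is infinite. An infinite subset of some `A k` on which `j`
is polynomially bounded in `i`, or else a diagonal sequence with one point from each `A k`,
contradicts `finite_of_bound`. -/
theorem MatrixSpace.exists_bound (x : MatrixSpace) : ∃ k : ℕ, ∀ r : ℕ, ∃ C : ℝ, ∀ i j : ℕ+,
    (i : ℝ) ^ r * ‖x.val (i, j)‖ ≤ C * (j : ℝ) ^ k := by
  by_contra! hx
  choose r hr using hx
  let A : ℕ → Set (ℕ+ × ℕ+) := fun k => {a | (a.2 : ℝ) ^ k ≤ (a.1 : ℝ) ^ r k * ‖x.val a‖}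
  have hA : ∀ k, (A k).Infinite := by
    intro k hfin
    -- The summand 1 forces the new point into `A k`; the sum makes its value larger than all values
    -- on `A k`.
    obtain ⟨i, j, hij⟩ := hr k (1 + ∑ a ∈ hfin.toFinset, (a.1 : ℝ) ^ r k * ‖x.val a‖)
    have hj : (1 : ℝ) ≤ (j : ℝ) ^ k := one_le_pow₀ (one_le_pnat_cast j)
    have hsum : 0 ≤ ∑ a ∈ hfin.toFinset, (a.1 : ℝ) ^ r k * ‖x.val a‖ :=
      Finset.sum_nonneg fun _ _ => by positivity
    have hmem : (i, j) ∈ A k := by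
      change (j : ℝ) ^ k ≤ (i : ℝ) ^ r k * ‖x.val (i, j)‖
      nlinarith
    have hle : (i : ℝ) ^ r k * ‖x.val (i, j)‖ ≤
        ∑ a ∈ hfin.toFinset, (a.1 : ℝ) ^ r k * ‖x.val a‖ :=
      Finset.single_le_sum (f := fun a : ℕ+ × ℕ+ => (a.1 : ℝ) ^ r k * ‖x.val a‖)
        (fun _ _ => by positivity) (hfin.mem_toFinset.2 hmem)
    nlinarith
  by_cases hcase : ∃ k R : ℕ, (A k ∩ {a | (a.2 : ℝ) ≤ (a.1 : ℝ) ^ R}).Infinite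
  -- Here `j ≤ i^R` and `1 ≤ i^(r k) |x_ij|`, so every power `j^l` is bounded by `i^(R l + r k)
  -- |x_ij|`.
  · obtain ⟨k, R, hinf⟩ := hcase
    refine hinf (x.finite_of_bound fun l => ⟨R * l + r k, 1, fun a ha => ?_⟩)
    have h1 : (1 : ℝ) ≤ (a.1 : ℝ) ^ r k * ‖x.val a‖ :=
      (one_le_pow₀ (one_le_pnat_cast a.2)).trans ha.1
    calc (a.2 : ℝ) ^ l ≤ ((a.1 : ℝ) ^ R) ^ l := pow_le_pow_left₀ (by positivity) ha.2 l
      _ ≤ ((a.1 : ℝ) ^ R) ^ l * ((a.1 : ℝ) ^ r k * ‖x.val a‖) :=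
        le_mul_of_one_le_right (by positivity) h1
      _ = _ := by rw [pow_add, pow_mul]; ring
  · push Not at hcase
    -- Only finitely many points of `A k` satisfy `j ≤ i^(r k)`, and only finitely many have `i + j
    -- ≤ k`. At any other point `j^k ≤ i^(r k) |x_ij| ≤ j |x_ij|`, whence `|x_ij| ≥ j^(k-1)` for `k
    -- ≥ 1`.
    have hpick : ∀ k : ℕ, ∃ a ∈ A k, (a.1 : ℝ) ^ r k < a.2 ∧ k < (a.1 : ℕ) + a.2 := by
      intro k
      have hf : {a : ℕ+ × ℕ+ | (a.1 : ℕ) + a.2 ≤ k}.Finite := by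
        refine Set.Finite.of_finite_image (f := fun a : ℕ+ × ℕ+ => ((a.1 : ℕ), (a.2 : ℕ)))
          ((Set.finite_Iic (k, k)).subset ?_) ?_
        · rintro _ ⟨a, ha, rfl⟩
          have ha' : (a.1 : ℕ) + a.2 ≤ k := ha
          exact ⟨by change (a.1 : ℕ) ≤ k; omega, by change (a.2 : ℕ) ≤ k; omega⟩
        · rintro a - b - h
          rw [Prod.mk.injEq] at h
          exact Prod.ext (PNat.coe_injective h.1) (PNat.coe_injective h.2)
      obtain ⟨a, ha, hna⟩ := ((hA k).sdiff ((hcase k (r k)).union hf)).nonempty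
      rw [Set.mem_union, not_or] at hna
      refine ⟨a, ha, lt_of_not_ge fun h => hna.1 ⟨ha, h⟩, lt_of_not_ge fun h => hna.2 h⟩
    choose a haA hlt hk using hpick
    have hfin : (Set.range a).Finite := by
      refine x.finite_of_bound fun l =>
        -- The 1 serves the points with `k > l`, where `|x| ≥ j^(k-1) ≥ j^l`; the sum serves the
        -- finitely many points with `k ≤ l`.
        ⟨0, 1 + ∑ k ∈ Finset.range (l + 1), ((a k).2 : ℝ) ^ l / ‖x.val (a k)‖, ?_⟩
      rintro _ ⟨k, rfl⟩
      have hj := one_le_pnat_cast (a k).2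
      have hAk : ((a k).2 : ℝ) ^ k ≤ ((a k).1 : ℝ) ^ r k * ‖x.val (a k)‖ := haA k
      have hpos : 0 < ‖x.val (a k)‖ := by
        refine (norm_nonneg _).lt_of_ne fun h2 => ?_
        rw [← h2, mul_zero] at hAk
        exact absurd hAk (not_le.2 (by positivity))
      have hnn : ∀ m ∈ Finset.range (l + 1), 0 ≤ ((a m).2 : ℝ) ^ l / ‖x.val (a m)‖ :=
        fun _ _ => by positivity
      rw [pow_zero, mul_one, ← div_le_iff₀ hpos]
      rcases le_or_gt k l with h | h
      · have := Finset.single_le_sum hnn (Finset.mem_range.2 (Nat.lt_succ_of_le h))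
        linarith
      · have h1 : ((a k).2 : ℝ) ^ l / ‖x.val (a k)‖ ≤ 1 := by
          rw [div_le_one hpos]
          obtain ⟨m, rfl⟩ : ∃ m, k = m + 1 := ⟨k - 1, by omega⟩
          refine (pow_le_pow_right₀ hj (Nat.lt_succ_iff.1 h)).trans ?_
          have h2 : ((a (m + 1)).2 : ℝ) ^ (m + 1) ≤ (a (m + 1)).2 * ‖x.val (a (m + 1))‖ :=
            hAk.trans (mul_le_mul_of_nonneg_right (hlt _).le (norm_nonneg _))
          rw [pow_succ'] at h2
          exact le_of_mul_le_mul_left h2 (by positivity)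
        have := Finset.sum_nonneg hnn
        linarith
    obtain ⟨N, hN⟩ := (hfin.image fun a : ℕ+ × ℕ+ => (a.1 : ℕ) + a.2).bddAbove
    exact absurd (hk N) (not_lt.2 (hN ⟨a N, ⟨N, rfl⟩, rfl⟩))

theorem exists_matrixWeight_ne_zero (a : ℕ+ × ℕ+) : ∃ w : MatrixWeight, w.1 a ≠ 0 := by
  refine ⟨⟨Pi.single a 1, fun k => ⟨0, (a.2 : ℝ) ^ k, fun i j => ?_⟩⟩, by simp⟩
  rw [Pi.single_apply]
  split_ifs with h
  · simp [← h]
  · simp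

instance : T2Space MatrixSpace := Kothe.t2Space exists_matrixWeight_ne_zero
instance : CompleteSpace MatrixSpace := Kothe.completeSpace exists_matrixWeight_ne_zero

/-! ### Rapidly decreasing sequences in a normed space -/

/-- The weights `i ^ r`. -/
def powWeight (r : ℕ) (i : ℕ+) : ℝ≥0 := (i : ℝ≥0) ^ r

theorem coe_powWeight (r : ℕ) (i : ℕ+) : (powWeight r i : ℝ) = (i : ℝ) ^ r := by
  simp [powWeight]

theorem exists_powWeight_ne_zero (i : ℕ+) : ∃ r, powWeight r i ≠ 0 := ⟨0, by simp [powWeight]⟩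

theorem powWeight_directed (r t : ℕ) :
    ∃ m, ∀ i, powWeight r i ≤ powWeight m i ∧ powWeight t i ≤ powWeight m i := by
  refine ⟨max r t, fun i => ?_⟩
  have hi : (1 : ℝ≥0) ≤ i := by exact_mod_cast i.pos
  exact ⟨pow_le_pow_right₀ hi (le_max_left _ _), pow_le_pow_right₀ hi (le_max_right _ _)⟩

section VecRapid

variable (F : Type*) [NormedAddCommGroup F] [NormedSpace ℂ F]

/-- The space of rapidly decreasing sequences in the normed space `F`. -/
abbrev VecRapid : Type _ := Kothe powWeight F

instance : T2Space (VecRapid F) := Kothe.t2Space exists_powWeight_ne_zero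
instance [CompleteSpace F] : CompleteSpace (VecRapid F) :=
  Kothe.completeSpace exists_powWeight_ne_zero

instance : FirstCountableTopology (VecRapid F) := Kothe.withSeminorms.firstCountableTopology

/-- Countably many seminorms and completeness give a Baire space. With `F = ℂ` this is the source of
the uniform boundedness arguments for `s`. -/
instance [CompleteSpace F] : BarrelledSpace ℂ (VecRapid F) :=
  have : (uniformity (VecRapid F)).IsCountablyGenerated :=
    IsUniformAddGroup.uniformity_countably_generated
  inferInstance

variable {F}

theorem VecRapid.exists_bound {q : Seminorm ℂ (VecRapid F)} (hq : Continuous q) :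
    ∃ (r : ℕ) (C : ℝ), 0 ≤ C ∧ ∀ x, q x ≤ C * Kothe.seminorm powWeight F r x :=
  Kothe.exists_bound_of_directed powWeight_directed hq

end VecRapid

/-- Two extra powers of `i` pay for the convergent series `∑ i⁻²`; this is how sup bounds are turned
into `ℓ¹` bounds. -/
theorem summable_pow_mul_of_bound {a : ℕ+ → ℝ} {C : ℝ} {r : ℕ} (ha : ∀ i, 0 ≤ a i)
    (h : ∀ i : ℕ+, (i : ℝ) ^ (r + 2) * a i ≤ C) :
    (Summable fun i : ℕ+ => (i : ℝ) ^ r * a i) ∧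
      ∑' i : ℕ+, (i : ℝ) ^ r * a i ≤ C * ∑' i : ℕ+, ((i : ℝ) ^ 2)⁻¹ := by
  have hle : ∀ i : ℕ+, (i : ℝ) ^ r * a i ≤ C * ((i : ℝ) ^ 2)⁻¹ := by
    intro i
    have hi := one_le_pnat_cast i
    rw [← div_eq_mul_inv, le_div_iff₀ (by positivity)]
    calc (i : ℝ) ^ r * a i * (i : ℝ) ^ 2 = (i : ℝ) ^ (r + 2) * a i := by ring
      _ ≤ C := h i
  have hs : Summable fun i : ℕ+ => (i : ℝ) ^ r * a i :=
    .of_nonneg_of_le (fun i => mul_nonneg (by positivity) (ha i)) hle (summable_inv_sq.mul_left C)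
  refine ⟨hs, ?_⟩
  rw [← tsum_mul_left]
  exact hs.tsum_le_tsum hle (summable_inv_sq.mul_left C)

namespace RapidSeq

theorem le_rapidSeminorm (r : ℕ) (x : RapidSeq) (i : ℕ+) :
    (i : ℝ) ^ r * ‖x.seq i‖ ≤ rapidSeminorm r x := le_ciSup (x.bdd r) i

theorem seq_injective : Function.Injective RapidSeq.seq := Subtype.val_injective

/-- The rapidly decreasing sequence given by a sequence. -/
def mk (x : ℕ+ → ℂ) (hx : ∀ r : ℕ, BddAbove (Set.range fun j : ℕ+ => (j : ℝ) ^ r * ‖x j‖)) :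
    RapidSeq := ⟨x, hx⟩

@[simp] theorem seq_mk (x : ℕ+ → ℂ)
    (hx : ∀ r : ℕ, BddAbove (Set.range fun j : ℕ+ => (j : ℝ) ^ r * ‖x j‖)) :
    (mk x hx).seq = x := rfl

theorem summable_pow_mul (x : RapidSeq) (r : ℕ) : Summable fun i : ℕ+ => (i : ℝ) ^ r * ‖x.seq i‖ :=
  (summable_pow_mul_of_bound (fun _ => norm_nonneg _) (le_rapidSeminorm (r + 2) x)).1

/-- The rapidly decreasing sequences as a Köthe space, algebraically. -/
def linearEquivVecRapid : RapidSeq ≃ₗ[ℂ] VecRapid ℂ where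
  toFun x := Kothe.mk x.seq fun r => by
    simpa only [coe_powWeight] using x.summable_pow_mul r
  map_add' _ _ := rfl
  map_smul' _ _ := rfl
  invFun y := mk y.val fun r => ⟨Kothe.seminorm powWeight ℂ r y, by
    rintro _ ⟨i, rfl⟩
    have := Kothe.le_seminorm r y i
    rwa [coe_powWeight] at this⟩
  left_inv _ := rfl
  right_inv _ := rfl

/-- The sup seminorms of `s` and the weighted `ℓ¹` seminorms define the same space. -/
def equivVecRapid : RapidSeq ≃L[ℂ] VecRapid ℂ where
  toLinearEquiv := linearEquivVecRapid
  continuous_toFun := by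
    refine withSeminorms_rapidSeq.continuous_of_isBounded Kothe.withSeminorms
      linearEquivVecRapid.toLinearMap fun r =>
      ⟨{r + 2}, ⟨∑' i : ℕ+, ((i : ℝ) ^ 2)⁻¹, tsum_nonneg fun _ => by positivity⟩, fun x => ?_⟩
    have h := (summable_pow_mul_of_bound (fun _ => norm_nonneg _) (le_rapidSeminorm (r + 2) x)).2
    simp only [← coe_powWeight r] at h
    rw [Finset.sup_singleton]
    refine h.trans_eq ?_
    rw [mul_comm]; rfl
  continuous_invFun := by
    refine Kothe.withSeminorms.continuous_of_isBounded withSeminorms_rapidSeq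
      linearEquivVecRapid.symm.toLinearMap fun r => ⟨{r}, 1, fun y => ?_⟩
    rw [Finset.sup_singleton, one_smul]
    refine ciSup_le fun i => ?_
    have := Kothe.le_seminorm r y i
    rwa [coe_powWeight] at this

@[simp] theorem val_equivVecRapid (x : RapidSeq) : (equivVecRapid x).val = x.seq := rfl

/-- The unit vectors of `s`. -/
def unit (i : ℕ+) : RapidSeq := equivVecRapid.symm (Kothe.single i 1)

@[simp] theorem seq_unit (i : ℕ+) : (unit i).seq = Pi.single i 1 := rfl

theorem equivVecRapid_unit (i : ℕ+) : equivVecRapid (unit i) = Kothe.single i 1 :=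
  equivVecRapid.apply_symm_apply _

theorem hasSum_unit (x : RapidSeq) : HasSum (fun i => x.seq i • unit i) x := by
  have h := (Kothe.hasSum_single (equivVecRapid x)).mapL equivVecRapid.symm.toContinuousLinearMap
  convert h using 2
  · refine seq_injective ?_
    rw [map_smul, seq_unit, ← Pi.single_smul, smul_eq_mul, mul_one]
    rfl
  · exact (equivVecRapid.symm_apply_apply x).symm

theorem exists_bound {q : Seminorm ℂ RapidSeq} (hq : Continuous q) :
    ∃ (r : ℕ) (C : ℝ), 0 ≤ C ∧
      ∀ x, q x ≤ C * Kothe.seminorm powWeight ℂ r (equivVecRapid x) := by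
  obtain ⟨r, C, hC, h⟩ := VecRapid.exists_bound
    (q := q.comp equivVecRapid.symm.toLinearEquiv.toLinearMap)
    (hq.comp equivVecRapid.symm.continuous)
  refine ⟨r, C, hC, fun x => ?_⟩
  simpa using h (equivVecRapid x)

theorem seminorm_unit (r : ℕ) (i : ℕ+) :
    Kothe.seminorm powWeight ℂ r (equivVecRapid (unit i)) = (i : ℝ) ^ r := by
  rw [equivVecRapid_unit, Kothe.seminorm_single, norm_one, mul_one, coe_powWeight]

/-- The space `s` is barrelled. -/
theorem continuous_iSup {κ : Type*} {p : κ → Seminorm ℂ RapidSeq} (hp : ∀ k, Continuous (p k))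
    (hb : ∀ x, BddAbove (Set.range fun k => p k x)) :
    ∃ q : Seminorm ℂ RapidSeq, Continuous q ∧ ∀ k x, p k x ≤ q x := by
  let p' : κ → Seminorm ℂ (VecRapid ℂ) := fun k =>
    (p k).comp equivVecRapid.symm.toLinearEquiv.toLinearMap
  have hb' : BddAbove (Set.range p') :=
    Seminorm.bddAbove_range_iff.2 fun y => hb (equivVecRapid.symm y)
  refine ⟨(⨆ k, p' k).comp equivVecRapid.toLinearEquiv.toLinearMap,
    Continuous.comp (g := ⇑(⨆ k, p' k)) ?_ equivVecRapid.continuous, fun k x => ?_⟩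
  · rw [Seminorm.coe_iSup_eq hb']
    exact Seminorm.continuous_iSup p' (fun k => (hp k).comp equivVecRapid.symm.continuous) hb'
  have h := le_ciSup hb' k (equivVecRapid x)
  simpa [p'] using h

end RapidSeq

/-! ### The completed projective tensor product of `s` and a normed space -/

section Proj

variable {F : Type*} [NormedAddCommGroup F] [NormedSpace ℂ F]

instance {E G : Type*} [AddCommGroup E] [Module ℂ E] [TopologicalSpace E] [AddCommGroup G]
    [Module ℂ G] [TopologicalSpace G] : PolynormableSpace ℂ (ProjTensor E G) :=
  (isLCTopology_projTensor E G).polynormableSpace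

variable (F) in
/-- The bilinear map `(x, f) ↦ (x_i f)`. -/
def VecRapid.tmul : RapidSeq →ₗ[ℂ] F →ₗ[ℂ] VecRapid F :=
  LinearMap.mk₂ ℂ
    (fun x f => Kothe.mk (fun i => x.seq i • f) fun r => by
      refine ((RapidSeq.equivVecRapid x).summable r |>.mul_right ‖f‖).congr fun i => ?_
      rw [norm_smul, RapidSeq.val_equivVecRapid, mul_assoc])
    (fun x y f => Kothe.val_injective (funext fun i => add_smul (x.seq i) (y.seq i) f))
    (fun c x f => Kothe.val_injective (funext fun i => mul_smul c (x.seq i) f))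
    (fun x f g => Kothe.val_injective (funext fun i => smul_add (x.seq i) f g))
    (fun c x f => Kothe.val_injective (funext fun i => smul_comm (x.seq i) c f))

@[simp] theorem VecRapid.val_tmul (x : RapidSeq) (f : F) (i : ℕ+) :
    (VecRapid.tmul F x f).val i = x.seq i • f := rfl

theorem VecRapid.seminorm_tmul (r : ℕ) (x : RapidSeq) (f : F) :
    Kothe.seminorm powWeight F r (VecRapid.tmul F x f) =
      Kothe.seminorm powWeight ℂ r (RapidSeq.equivVecRapid x) * ‖f‖ := by
  rw [Kothe.seminorm_apply, Kothe.seminorm_apply, ← tsum_mul_right]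
  refine tsum_congr fun i => ?_
  rw [VecRapid.val_tmul, norm_smul, RapidSeq.val_equivVecRapid, mul_assoc]

theorem VecRapid.tmul_unit (i : ℕ+) (f : F) :
    VecRapid.tmul F (RapidSeq.unit i) f = Kothe.single i f := by
  refine Kothe.val_injective (funext fun j => ?_)
  rw [val_tmul, RapidSeq.seq_unit, Kothe.val_single, Pi.single_apply, Pi.single_apply]
  split_ifs <;> simp

theorem VecRapid.continuous_tmul :
    Continuous fun z : RapidSeq × F => VecRapid.tmul F z.1 z.2 := by
  refine continuous_iff_continuousAt.2 fun z₀ =>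
    (Kothe.withSeminorms.tendsto_nhds _ _).2 fun r ε hε => ?_
  have hP : Continuous fun x : RapidSeq =>
      Kothe.seminorm powWeight ℂ r (RapidSeq.equivVecRapid x) :=
    (Kothe.continuous_seminorm r).comp RapidSeq.equivVecRapid.continuous
  -- The bound comes from `x ⊗ f - x₀ ⊗ f₀ = (x - x₀) ⊗ f + x₀ ⊗ (f - f₀)`.
  have hg : Continuous fun z : RapidSeq × F =>
      Kothe.seminorm powWeight ℂ r (RapidSeq.equivVecRapid (z.1 - z₀.1)) * ‖z.2‖ +
        Kothe.seminorm powWeight ℂ r (RapidSeq.equivVecRapid z₀.1) * ‖z.2 - z₀.2‖ :=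
    ((hP.comp (continuous_fst.sub continuous_const)).mul continuous_snd.norm).add
      (continuous_const.mul (continuous_snd.sub continuous_const).norm)
  have h0 := hg.tendsto z₀
  simp only [sub_self, map_zero, zero_mul, norm_zero, mul_zero, add_zero] at h0
  filter_upwards [(tendsto_order.1 h0).2 ε hε] with z hz
  refine lt_of_le_of_lt ?_ hz
  rw [← VecRapid.seminorm_tmul, ← VecRapid.seminorm_tmul]
  refine le_of_eq_of_le (congrArg _ ?_) (map_add_le_add _ _ _)
  rw [map_sub, LinearMap.sub_apply, map_sub, sub_add_sub_cancel]

/-- The elementary tensors of `E ⊗ G` with the projective topology. -/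
def ProjTensor.tmul {E G : Type*} [AddCommGroup E] [Module ℂ E] [TopologicalSpace E]
    [AddCommGroup G] [Module ℂ G] [TopologicalSpace G] : E →ₗ[ℂ] G →ₗ[ℂ] ProjTensor E G :=
  TensorProduct.mk ℂ E G

theorem ProjTensor.continuous_tmul {E G : Type*} [AddCommGroup E] [Module ℂ E]
    [TopologicalSpace E] [AddCommGroup G] [Module ℂ G] [TopologicalSpace G] :
    Continuous fun z : E × G => ProjTensor.tmul z.1 z.2 :=
  continuous_projTopology_tmul

theorem ProjTensor.induction_on {E G : Type*} [AddCommGroup E] [Module ℂ E]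
    [TopologicalSpace E] [AddCommGroup G] [Module ℂ G] [TopologicalSpace G]
    {motive : ProjTensor E G → Prop} (t : ProjTensor E G) (zero : motive 0)
    (tmul : ∀ x y, motive (ProjTensor.tmul x y))
    (add : ∀ s t, motive s → motive t → motive (s + t)) : motive t :=
  TensorProduct.induction_on (motive := motive) t zero tmul add

variable (F) in
/-- The map `s ⊗_π F → s(F)`. -/
def projToVec : ProjTensor RapidSeq F →L[ℂ] VecRapid F where
  toLinearMap := (TensorProduct.lift (VecRapid.tmul F) : RapidSeq ⊗[ℂ] F →ₗ[ℂ] VecRapid F)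
  cont := by
    change @Continuous (RapidSeq ⊗[ℂ] F) _ (projTopology RapidSeq F) _
      (TensorProduct.lift (VecRapid.tmul F))
    rw [continuous_iff_le_induced]
    refine sInf_le ⟨IsLCTopology.induced Kothe.withSeminorms.isLCTopology _, ?_⟩
    exact continuous_induced_rng.2 VecRapid.continuous_tmul

theorem projToVec_tmul (x : RapidSeq) (f : F) :
    projToVec F (ProjTensor.tmul x f) = VecRapid.tmul F x f :=
  TensorProduct.lift.tmul (f' := VecRapid.tmul F) x f

/-- For an elementary tensor, `· ⊗ f` is applied to the expansion of `x` in unit vectors; the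
general case is linear. -/
theorem hasSum_projTensor (t : ProjTensor RapidSeq F) :
    HasSum (fun i => ProjTensor.tmul (RapidSeq.unit i) ((projToVec F t).val i)) t := by
  induction t using ProjTensor.induction_on with
  | zero => simp [hasSum_zero]
  | tmul x f =>
    have hc : Continuous (ProjTensor.tmul.flip f : RapidSeq →ₗ[ℂ] ProjTensor RapidSeq F) :=
      ProjTensor.continuous_tmul.comp (continuous_id.prodMk continuous_const)
    convert x.hasSum_unit.map (ProjTensor.tmul.flip f : RapidSeq →ₗ[ℂ] ProjTensor RapidSeq F) hc
      using 2
    · rw [projToVec_tmul, VecRapid.val_tmul, map_smul, Function.comp_apply, map_smul]; rfl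
    · rfl
  | add t u ht hu => simpa only [map_add, Pi.add_apply] using ht.add hu

/-- The seminorms `q(· ⊗ f)` with `‖f‖ ≤ 1` are pointwise bounded on the barrelled space `s`, hence
dominated by a single continuous seminorm, which is evaluated at the unit vectors. -/
theorem exists_seminorm_tmul_unit_le {q : Seminorm ℂ (ProjTensor RapidSeq F)} (hq : Continuous q) :
    ∃ (r : ℕ) (C : ℝ), 0 ≤ C ∧ ∀ (i : ℕ+) (f : F),
      q (ProjTensor.tmul (RapidSeq.unit i) f) ≤ C * ((i : ℝ) ^ r * ‖f‖) := by
  let p : {f : F // ‖f‖ ≤ 1} → Seminorm ℂ RapidSeq := fun f => q.comp (ProjTensor.tmul.flip f.1)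
  obtain ⟨q', hq', hle⟩ := RapidSeq.continuous_iSup (p := p)
    (fun f => hq.comp (ProjTensor.continuous_tmul.comp (continuous_id.prodMk continuous_const)))
    (fun x => by
      have hc : Continuous (q.comp (ProjTensor.tmul x : F →ₗ[ℂ] ProjTensor RapidSeq F)) :=
        hq.comp (ProjTensor.continuous_tmul.comp (continuous_const.prodMk continuous_id))
      obtain ⟨C, hC, h⟩ := Seminorm.bound_of_continuous_normedSpace _ hc
      refine ⟨C, ?_⟩
      rintro _ ⟨f, rfl⟩
      exact (h f.1).trans (mul_le_of_le_one_right hC.le f.2))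
  obtain ⟨r, C, hC, h⟩ := RapidSeq.exists_bound hq'
  refine ⟨r, C, hC, fun i f => ?_⟩
  have hi : q' (RapidSeq.unit i) ≤ C * (i : ℝ) ^ r := by
    simpa only [RapidSeq.seminorm_unit] using h (RapidSeq.unit i)
  rcases eq_or_ne f 0 with rfl | hf
  · simp
  have hf' : 0 < ‖f‖ := norm_pos_iff.2 hf
  have h1 : ‖((‖f‖⁻¹ : ℝ) : ℂ) • f‖ ≤ 1 := by
    rw [norm_smul, Complex.norm_real, norm_inv, norm_norm, inv_mul_cancel₀ hf'.ne']
  have h2 : q (ProjTensor.tmul (RapidSeq.unit i) (((‖f‖⁻¹ : ℝ) : ℂ) • f)) ≤ C * (i : ℝ) ^ r :=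
    (hle ⟨_, h1⟩ (RapidSeq.unit i)).trans hi
  rw [map_smul, map_smul_eq_mul, Complex.norm_real, norm_inv, norm_norm, ← div_eq_inv_mul,
    div_le_iff₀ hf', mul_assoc] at h2
  exact h2

/-- With `t = ∑ e_i ⊗ t_i` one gets `q(t) ≤ ∑ q(e_i ⊗ t_i) ≤ C ∑ i^r ‖t_i‖`, a multiple of a
defining seminorm of `VecRapid F`. -/
theorem isInducing_projToVec : IsInducing (projToVec F) := by
  refine isInducing_of_forall_seminorm_le _ fun q hq => ?_
  obtain ⟨r, C, hC, h⟩ := exists_seminorm_tmul_unit_le hq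
  lift C to ℝ≥0 using hC
  refine ⟨C • Kothe.seminorm powWeight F r,
    (Kothe.continuous_seminorm r).const_smul C, fun t => ?_⟩
  have hs := ((projToVec F t).summable r).mul_left (C : ℝ)
  refine (seminorm_le_tsum hq (hasSum_projTensor t) hs fun i => ?_).trans_eq tsum_mul_left
  rw [coe_powWeight]
  exact h i _

theorem denseRange_projToVec : DenseRange (projToVec F) := by
  intro y
  refine mem_closure_of_tendsto (Kothe.hasSum_single y) (Eventually.of_forall fun s => ?_)
  refine ⟨∑ i ∈ s, ProjTensor.tmul (RapidSeq.unit i) (y.val i), ?_⟩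
  rw [map_sum]
  refine Finset.sum_congr rfl fun i _ => ?_
  rw [projToVec_tmul, VecRapid.tmul_unit]

variable [CompleteSpace F]

variable (F) in
/-- `s ⊗̂_π F = s(F)` for Banach spaces `F`. -/
def completedProjEquiv : CompletedProj RapidSeq F ≃L[ℂ] VecRapid F :=
  completionEquiv (projToVec F) isInducing_projToVec denseRange_projToVec

theorem completedProjEquiv_tmul (x : RapidSeq) (f : F) :
    completedProjEquiv F (CompletedProj.tmul x f) = VecRapid.tmul F x f :=
  (completionEquiv_coe _ _ _ _).trans (projToVec_tmul x f)

end Proj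

/-! ### The strong topology of `s'` -/

/-- The rapidly decreasing sequences of nonnegative numbers. -/
def RapidWeight : Type :=
  {v : ℕ+ → ℝ≥0 // ∀ k : ℕ, ∃ C : ℝ, ∀ j : ℕ+, (v j : ℝ) * (j : ℝ) ^ k ≤ C}

theorem RapidWeight.directed (u v : RapidWeight) :
    ∃ m : RapidWeight, ∀ j, u.1 j ≤ m.1 j ∧ v.1 j ≤ m.1 j := by
  refine ⟨⟨u.1 + v.1, fun k => ?_⟩, fun j => ⟨le_self_add, le_add_self⟩⟩
  obtain ⟨C, hC⟩ := u.2 k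
  obtain ⟨D, hD⟩ := v.2 k
  refine ⟨C + D, fun j => ?_⟩
  rw [Pi.add_apply, NNReal.coe_add, add_mul]
  exact add_le_add (hC j) (hD j)

instance : Nonempty RapidWeight := ⟨⟨0, fun _ => ⟨0, by simp⟩⟩⟩

instance : IsTopologicalAddGroup SlowSeq := topologicalAddGroup_induced SlowSeq.toDual
instance : ContinuousSMul ℂ SlowSeq := continuousSMul_induced SlowSeq.toDual

namespace SlowSeq

theorem exists_bound (y : SlowSeq) : ∃ (k : ℕ) (C : ℝ), 0 ≤ C ∧
    ∀ j : ℕ+, ‖y.seq j‖ ≤ C * (j : ℝ) ^ k := by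
  obtain ⟨k, C, h⟩ := id y.2
  exact ⟨k, |C|, abs_nonneg C, fun j => (h j).trans
    (mul_le_mul_of_nonneg_right (le_abs_self C) (by positivity))⟩

/-- Slowly increasing sequences are summable against rapidly decreasing ones. -/
def toKothe : SlowSeq →ₗ[ℂ] Kothe (fun v : RapidWeight => v.1) ℂ where
  toFun y := Kothe.mk y.seq fun v => by
    obtain ⟨k, C, hC, h⟩ := y.exists_bound
    obtain ⟨D, hD⟩ := v.2 (k + 2)
    refine .of_nonneg_of_le (fun j => by positivity) (fun j => ?_)
      (summable_inv_sq.mul_left (C * D))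
    have hj := one_le_pnat_cast j
    rw [← div_eq_mul_inv, le_div_iff₀ (by positivity)]
    calc (v.1 j : ℝ) * ‖y.seq j‖ * (j : ℝ) ^ 2 ≤ (v.1 j : ℝ) * (C * (j : ℝ) ^ k) * (j : ℝ) ^ 2 := by
          gcongr; exact h j
      _ = C * ((v.1 j : ℝ) * (j : ℝ) ^ (k + 2)) := by ring
      _ ≤ C * D := by gcongr; exact hD j
  map_add' _ _ := rfl
  map_smul' _ _ := rfl

@[simp] theorem val_toKothe (y : SlowSeq) : y.toKothe.val = y.seq := rfl

theorem toDual_apply (y : SlowSeq) (x : RapidSeq) :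
    y.toDual x = ∑' j, x.seq j * y.seq j := rfl

/-- The set of all sequences in `s` dominated by a given one is bounded. -/
theorem isVonNBounded_dominated (v : RapidWeight) :
    Bornology.IsVonNBounded ℂ {x : RapidSeq | ∀ j, ‖x.seq j‖ ≤ v.1 j} := by
  refine withSeminorms_rapidSeq.isVonNBounded_iff_seminorm_bounded.2 fun r => ?_
  obtain ⟨C, hC⟩ := v.2 r
  refine ⟨|C| + 1, by positivity, fun x hx => ?_⟩
  refine lt_of_le_of_lt (ciSup_le fun j => ?_) (lt_add_one |C|)
  calc (j : ℝ) ^ r * ‖x.seq j‖ ≤ (j : ℝ) ^ r * v.1 j := by gcongr; exact hx j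
    _ = v.1 j * (j : ℝ) ^ r := mul_comm _ _
    _ ≤ |C| := (hC j).trans (le_abs_self C)

theorem norm_toDual_le (y : SlowSeq) (v : RapidWeight) {x : RapidSeq}
    (hx : ∀ j, ‖x.seq j‖ ≤ v.1 j) :
    ‖y.toDual x‖ ≤ Kothe.seminorm (fun v : RapidWeight => v.1) ℂ v y.toKothe := by
  refine tsum_of_norm_bounded (y.toKothe.summable v).hasSum fun j => ?_
  rw [norm_mul, val_toKothe]
  gcongr
  exact hx j

/-- Together with `norm_toDual_le` this shows that `∑ v_j |y_j|` is the maximum of `|⟨x, y⟩|` over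
the bounded set of all `x` dominated by `v`. -/
theorem exists_toDual_eq (y : SlowSeq) (v : RapidWeight) :
    ∃ x : RapidSeq, (∀ j, ‖x.seq j‖ ≤ v.1 j) ∧
      y.toDual x = (Kothe.seminorm (fun v : RapidWeight => v.1) ℂ v y.toKothe : ℂ) := by
  -- The phases are chosen to make each product `x_j y_j` equal to `v_j |y_j|`; where `y_j = 0` the
  -- quotient is 0.
  let x₀ : ℕ+ → ℂ := fun j => (v.1 j : ℂ) * (star (y.seq j) / ‖y.seq j‖)
  have hx₀ : ∀ j, ‖x₀ j‖ ≤ v.1 j := by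
    intro j
    have h : ‖star (y.seq j) / (‖y.seq j‖ : ℂ)‖ ≤ 1 := by
      rw [norm_div, norm_star, Complex.norm_real, norm_norm]
      exact div_self_le_one _
    rw [norm_mul]
    refine (mul_le_of_le_one_right (norm_nonneg _) h).trans_eq ?_
    simp
  refine ⟨RapidSeq.mk x₀ fun r => ?_, hx₀, ?_⟩
  · obtain ⟨C, hC⟩ := v.2 r
    refine ⟨C, ?_⟩
    rintro _ ⟨j, rfl⟩
    refine le_trans ?_ (hC j)
    change (j : ℝ) ^ r * ‖x₀ j‖ ≤ v.1 j * (j : ℝ) ^ r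
    rw [mul_comm]
    exact mul_le_mul_of_nonneg_right (hx₀ j) (by positivity)
  · rw [toDual_apply, Kothe.seminorm_apply, Complex.ofReal_tsum]
    refine tsum_congr fun j => ?_
    rw [RapidSeq.seq_mk, val_toKothe]
    change (v.1 j : ℂ) * (star (y.seq j) / ‖y.seq j‖) * y.seq j = _
    rcases eq_or_ne (y.seq j) 0 with h | h
    · simp [h]
    · have h' : (‖y.seq j‖ : ℂ) ≠ 0 := by exact_mod_cast norm_ne_zero_iff.2 h
      have h2 : star (y.seq j) * y.seq j = (‖y.seq j‖ : ℂ) ^ 2 := Complex.conj_mul' _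
      rw [mul_assoc, div_mul_eq_mul_div, h2, sq, mul_div_assoc, div_self h', mul_one]
      push_cast; rfl

theorem continuous_toKothe : Continuous toKothe := by
  refine Kothe.withSeminorms.continuous_of_continuous_comp _ fun v => ?_
  refine Seminorm.continuous' (r := 1) ?_
  rw [nhds_induced, map_zero]
  refine ⟨_, ContinuousLinearMap.eventually_nhds_zero_mapsTo (isVonNBounded_dominated v)
    (Metric.closedBall_mem_nhds (0 : ℂ) one_pos), fun y hy => ?_⟩
  rw [Seminorm.mem_closedBall_zero, Seminorm.comp_apply]
  obtain ⟨x, hx, hxy⟩ := y.exists_toDual_eq v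
  have h := hy hx
  rw [mem_closedBall_zero_iff, hxy, Complex.norm_real, Real.norm_of_nonneg (apply_nonneg _ _)] at h
  exact h

/-- Every bounded subset of `s` is dominated by a single rapidly decreasing sequence, so the
seminorms `∑ v_j |y_j|` already generate the strong topology. -/
theorem isInducing_toKothe : IsInducing toKothe := by
  refine (IsTopologicalAddGroup.isInducing_iff_nhds_zero (f := toKothe)).2
    (le_antisymm (tendsto_iff_comap.1 (map_zero toKothe ▸ continuous_toKothe.tendsto 0))
      fun U hU => ?_)
  rw [nhds_induced, map_zero] at hU
  obtain ⟨V, hV, hVU⟩ := hU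
  obtain ⟨⟨S, N⟩, ⟨hS, hN⟩, hSN⟩ :=
    (ContinuousLinearMap.hasBasis_nhds_zero (𝕜₁ := ℂ) (E := RapidSeq)).mem_iff.1 hV
  obtain ⟨ε, hε, hεN⟩ := Metric.mem_nhds_iff.1 hN
  have hb : ∀ r, ∃ C, 0 ≤ C ∧ ∀ x ∈ S, ∀ j : ℕ+, (j : ℝ) ^ r * ‖x.seq j‖ ≤ C := by
    intro r
    obtain ⟨C, hC, h⟩ := withSeminorms_rapidSeq.isVonNBounded_iff_seminorm_bounded.1 hS r
    exact ⟨C, hC.le, fun x hx j => (RapidSeq.le_rapidSeminorm r x j).trans (h x hx).le⟩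
  have hbdd : ∀ j : ℕ+, BddAbove (Set.range fun x : S => ‖x.1.seq j‖₊) := by
    intro j
    obtain ⟨C, hC, h⟩ := hb 0
    lift C to ℝ≥0 using hC
    refine ⟨C, ?_⟩
    rintro _ ⟨x, rfl⟩
    rw [← NNReal.coe_le_coe, coe_nnnorm]
    simpa using h x.1 x.2 j
  -- The pointwise supremum over `S` decreases rapidly because each seminorm of `s` is bounded on
  -- `S`; for empty `S` it is 0.
  let v : RapidWeight := ⟨fun j => ⨆ x : S, ‖x.1.seq j‖₊, fun k => by
    obtain ⟨C, hC, h⟩ := hb k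
    refine ⟨C, fun j => ?_⟩
    have hj := one_le_pnat_cast j
    rw [← le_div_iff₀ (by positivity)]
    lift C to ℝ≥0 using hC
    have : (⨆ x : S, ‖x.1.seq j‖₊) ≤ C / (j : ℝ≥0) ^ k := by
      refine ciSup_le' fun x => ?_
      rw [← NNReal.coe_le_coe]
      push_cast
      rw [le_div_iff₀ (by positivity), mul_comm]
      exact h x.1 x.2 j
    exact_mod_cast this⟩
  have hxv : ∀ x ∈ S, ∀ j, ‖x.seq j‖ ≤ v.1 j := fun x hx j =>
    NNReal.coe_le_coe.2 (le_ciSup (hbdd j) ⟨x, hx⟩)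
  refine ⟨(Kothe.seminorm (fun v : RapidWeight => v.1) ℂ v).ball 0 ε,
    Seminorm.ball_mem_nhds (Kothe.continuous_seminorm v) hε, fun y hy => hVU (hSN fun x hx => ?_)⟩
  refine hεN ?_
  rw [mem_ball_zero_iff]
  exact (y.norm_toDual_le v (hxv x hx)).trans_lt ((Seminorm.mem_ball_zero _).1 hy)

instance : PolynormableSpace ℂ SlowSeq := isInducing_toKothe.polynormableSpace

/-- The unit vectors of `s'`. -/
def unit (j : ℕ+) : SlowSeq := ⟨Pi.single j 1, 0, 1, fun i => by
  rw [Pi.single_apply]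
  split_ifs <;> simp⟩

@[simp] theorem seq_unit (j : ℕ+) : (unit j).seq = Pi.single j 1 := rfl

theorem hasSum_unit (y : SlowSeq) : HasSum (fun j => y.seq j • unit j) y := by
  refine (isInducing_toKothe.hasSum_iff (g := toKothe) _ _).1 ?_
  convert Kothe.hasSum_single y.toKothe using 2 with j
  refine Kothe.val_injective ?_
  rw [Function.comp_apply, map_smul, map_smul, val_toKothe, seq_unit, Kothe.val_single,
    val_toKothe, ← Pi.single_smul, smul_eq_mul, mul_one]

theorem exists_seminorm_bound {q : Seminorm ℂ SlowSeq} (hq : Continuous q) :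
    ∃ (v : RapidWeight) (C : ℝ), 0 ≤ C ∧ ∀ y : SlowSeq,
      q y ≤ C * Kothe.seminorm (fun v : RapidWeight => v.1) ℂ v y.toKothe := by
  obtain ⟨p, hp, hqp⟩ := Seminorm.exists_le_comp_of_isInducing hq isInducing_toKothe
  obtain ⟨v, C, hC, h⟩ := Kothe.exists_bound_of_directed RapidWeight.directed hp
  exact ⟨v, C, hC, fun y => (hqp y).trans (h _)⟩

end SlowSeq

/-! ### The completed inductive tensor product of `s` and `s'` -/

section IndTensor

variable {E G : Type*} [AddCommGroup E] [Module ℂ E] [TopologicalSpace E]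
  [AddCommGroup G] [Module ℂ G] [TopologicalSpace G]

instance : PolynormableSpace ℂ (IndTensor E G) := (isLCTopology_indTensor E G).polynormableSpace

/-- The elementary tensors of `E ⊗ G` with the inductive topology. -/
def IndTensor.tmul : E →ₗ[ℂ] G →ₗ[ℂ] IndTensor E G := TensorProduct.mk ℂ E G

theorem IndTensor.continuous_tmul_right (x : E) :
    Continuous (IndTensor.tmul x : G →ₗ[ℂ] IndTensor E G) :=
  continuous_sInf_rng.2 fun _ ht => ht.2.1 x

theorem IndTensor.continuous_tmul_left (y : G) :
    Continuous (IndTensor.tmul.flip y : E →ₗ[ℂ] IndTensor E G) :=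
  continuous_sInf_rng.2 fun _ ht => ht.2.2 y

end IndTensor

theorem IndTensor.induction_on {E G : Type*} [AddCommGroup E] [Module ℂ E]
    [AddCommGroup G] [Module ℂ G] {motive : IndTensor E G → Prop} (t : IndTensor E G)
    (zero : motive 0) (tmul : ∀ x y, motive (IndTensor.tmul x y))
    (add : ∀ s t, motive s → motive t → motive (s + t)) : motive t :=
  TensorProduct.induction_on (motive := motive) t zero tmul add

namespace MatrixSpace

/-- Summability against a matrix weight of the matrices dominated by `b_i j ^ n`. -/
theorem exists_tsum_bound (w : MatrixWeight) (n : ℕ) : ∃ (r : ℕ) (C : ℝ), 0 ≤ C ∧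
    ∀ (b : ℕ+ → ℝ) (m : ℕ+ × ℕ+ → ℝ), (∀ a, 0 ≤ m a) →
      (∀ i j : ℕ+, m (i, j) ≤ b i * (j : ℝ) ^ n) → (Summable fun i : ℕ+ => (i : ℝ) ^ r * b i) →
      (Summable fun a => (w.1 a : ℝ) * m a) ∧
        ∑' a, (w.1 a : ℝ) * m a ≤ C * ∑' i : ℕ+, (i : ℝ) ^ r * b i := by
  -- The exponent `n` absorbs the growth of `m` in `j`, and the remaining 2 makes the sum over `j`
  -- converge.
  obtain ⟨r, D, hD⟩ := w.2 (n + 2)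
  refine ⟨r, |D| * ∑' j : ℕ+, ((j : ℝ) ^ 2)⁻¹, by positivity, fun b m hm hb hs => ?_⟩
  have hb0 : ∀ i, 0 ≤ b i := fun i =>
    nonneg_of_mul_nonneg_left ((hm _).trans (hb i 1)) (by simp)
  have h1 := hs.mul_left |D|
  have h3 := h1.mul_of_nonneg summable_inv_sq
    (fun i => mul_nonneg (abs_nonneg _) (mul_nonneg (by positivity) (hb0 i)))
    fun _ => by positivity
  have hle : ∀ a : ℕ+ × ℕ+, (w.1 a : ℝ) * m a ≤
      |D| * ((a.1 : ℝ) ^ r * b a.1) * ((a.2 : ℝ) ^ 2)⁻¹ := by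
    rintro ⟨i, j⟩
    have hj := one_le_pnat_cast j
    rw [← div_eq_mul_inv, le_div_iff₀ (by positivity)]
    calc (w.1 (i, j) : ℝ) * m (i, j) * (j : ℝ) ^ 2
        ≤ (w.1 (i, j) : ℝ) * (b i * (j : ℝ) ^ n) * (j : ℝ) ^ 2 := by gcongr; exact hb i j
      _ = (w.1 (i, j) : ℝ) * (j : ℝ) ^ (n + 2) * b i := by ring
      _ ≤ |D| * (i : ℝ) ^ r * b i := mul_le_mul_of_nonneg_right ((hD i j).trans
          (mul_le_mul_of_nonneg_right (le_abs_self D) (by positivity))) (hb0 i)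
      _ = _ := by ring
  have hs' : Summable fun a => (w.1 a : ℝ) * m a :=
    .of_nonneg_of_le (fun a => mul_nonneg (by positivity) (hm a)) hle h3
  refine ⟨hs', (hs'.tsum_le_tsum hle h3).trans_eq ?_⟩
  rw [← h1.tsum_mul_tsum summable_inv_sq h3, tsum_mul_left]
  ring

theorem exists_summable_bound (w : MatrixWeight) (y : SlowSeq) :
    ∃ (r : ℕ) (C : ℝ), 0 ≤ C ∧ ∀ x : RapidSeq,
      (Summable fun a : ℕ+ × ℕ+ => (w.1 a : ℝ) * ‖x.seq a.1 * y.seq a.2‖) ∧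
      ∑' a : ℕ+ × ℕ+, (w.1 a : ℝ) * ‖x.seq a.1 * y.seq a.2‖ ≤
        C * Kothe.seminorm powWeight ℂ r (RapidSeq.equivVecRapid x) := by
  obtain ⟨k, D, hD, hy⟩ := y.exists_bound
  obtain ⟨r, C, hC, h⟩ := exists_tsum_bound w k
  refine ⟨r, C * D, by positivity, fun x => ?_⟩
  have hs : Summable fun i : ℕ+ => (i : ℝ) ^ r * (‖x.seq i‖ * D) := by
    simpa only [mul_assoc] using (x.summable_pow_mul r).mul_right D
  obtain ⟨h1, h2⟩ := h (fun i => ‖x.seq i‖ * D) (fun a => ‖x.seq a.1 * y.seq a.2‖)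
    (fun _ => norm_nonneg _)
    (fun i j => by rw [norm_mul, mul_assoc]; gcongr; exact hy j) hs
  refine ⟨h1, h2.trans_eq ?_⟩
  rw [Kothe.seminorm_apply]
  simp only [coe_powWeight, RapidSeq.val_equivVecRapid, ← mul_assoc, tsum_mul_right]
  ring

/-- The bilinear map `(x, y) ↦ (x_i y_j)`. -/
def tmul : RapidSeq →ₗ[ℂ] SlowSeq →ₗ[ℂ] MatrixSpace :=
  LinearMap.mk₂ ℂ
    (fun x y => Kothe.mk (fun a => x.seq a.1 * y.seq a.2) fun w =>
      ((exists_summable_bound w y).choose_spec.choose_spec.2 x).1)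
    (fun x y _ => Kothe.val_injective (funext fun a => add_mul (x.seq a.1) (y.seq a.1) _))
    (fun c x _ => Kothe.val_injective (funext fun a => mul_assoc c (x.seq a.1) _))
    (fun x y _ => Kothe.val_injective (funext fun a => mul_add (x.seq a.1) (y.seq a.2) _))
    (fun c x _ => Kothe.val_injective (funext fun a => mul_left_comm (x.seq a.1) c _))

@[simp] theorem val_tmul (x : RapidSeq) (y : SlowSeq) (a : ℕ+ × ℕ+) :
    (tmul x y).val a = x.seq a.1 * y.seq a.2 := rfl

theorem tmul_unit (i j : ℕ+) :
    tmul (RapidSeq.unit i) (SlowSeq.unit j) = Kothe.single (i, j) 1 := by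
  refine Kothe.val_injective (funext fun a => ?_)
  rw [val_tmul, RapidSeq.seq_unit, SlowSeq.seq_unit, Kothe.val_single, Pi.single_apply,
    Pi.single_apply, Pi.single_apply]
  by_cases h1 : a.1 = i <;> by_cases h2 : a.2 = j <;> simp [Prod.ext_iff, h1, h2]

theorem continuous_tmul_left (y : SlowSeq) : Continuous (tmul.flip y) := by
  refine Kothe.withSeminorms.continuous_of_continuous_comp _ fun w => ?_
  obtain ⟨r, C, hC, h⟩ := exists_summable_bound w y
  lift C to ℝ≥0 using hC
  refine Seminorm.continuous_of_le
    (q := C • (Kothe.seminorm powWeight ℂ r).comp RapidSeq.equivVecRapid.toLinearEquiv.toLinearMap)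
    (Continuous.const_smul
      ((Kothe.continuous_seminorm r).comp RapidSeq.equivVecRapid.continuous) C) fun x => ?_
  exact (h x).2

/-- The sums `∑_i w_ij |x_i|`. -/
def rowWeight (w : MatrixWeight) (x : RapidSeq) : RapidWeight :=
  ⟨fun j => ∑' i, w.1 (i, j) * ‖x.seq i‖₊, fun k => by
    -- Termwise `w_ij |x_i| j^k ≤ C i^r |x_i|`, with a right side that is summable in `i` and free
    -- of `j`.
    obtain ⟨r, C, h⟩ := w.2 k
    have hs := (x.summable_pow_mul r).mul_left C
    refine ⟨∑' i : ℕ+, C * ((i : ℝ) ^ r * ‖x.seq i‖), fun j => ?_⟩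
    rw [NNReal.coe_tsum, ← tsum_mul_right]
    have hle : ∀ i : ℕ+, ((w.1 (i, j) * ‖x.seq i‖₊ : ℝ≥0) : ℝ) * (j : ℝ) ^ k ≤
        C * ((i : ℝ) ^ r * ‖x.seq i‖) := by
      intro i
      rw [NNReal.coe_mul, coe_nnnorm, ← mul_assoc, mul_right_comm]
      exact mul_le_mul_of_nonneg_right (h i j) (norm_nonneg _)
    exact (Summable.of_nonneg_of_le (fun _ => by positivity) hle hs).tsum_le_tsum hle hs⟩

/-- Summing over `i` before `j` turns a seminorm of `x ⊗ y`, for fixed `x`, into a strong-dual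
seminorm of `y`. -/
theorem seminorm_tmul_eq (w : MatrixWeight) (x : RapidSeq) (y : SlowSeq) :
    Kothe.seminorm (fun w : MatrixWeight => w.1) ℂ w (tmul x y) =
      Kothe.seminorm (fun v : RapidWeight => v.1) ℂ (rowWeight w x) y.toKothe := by
  have hs := (Equiv.prodComm ℕ+ ℕ+).summable_iff.2 ((tmul x y).summable w)
  rw [Kothe.seminorm_apply, Kothe.seminorm_apply, ← (Equiv.prodComm ℕ+ ℕ+).tsum_eq]
  refine (hs.tsum_prod).trans (tsum_congr fun j => ?_)
  change ∑' i, (w.1 (i, j) : ℝ) * ‖x.seq i * y.seq j‖ =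
    ((∑' i, w.1 (i, j) * ‖x.seq i‖₊ : ℝ≥0) : ℝ) * ‖y.seq j‖
  rw [NNReal.coe_tsum, ← tsum_mul_right]
  refine tsum_congr fun i => ?_
  rw [norm_mul, NNReal.coe_mul, coe_nnnorm, mul_assoc]

theorem continuous_tmul_right (x : RapidSeq) : Continuous (tmul x) := by
  refine Kothe.withSeminorms.continuous_of_continuous_comp _ fun w => ?_
  refine Seminorm.continuous_of_le
    (q := (Kothe.seminorm (fun v : RapidWeight => v.1) ℂ (rowWeight w x)).comp SlowSeq.toKothe)
    ((Kothe.continuous_seminorm _).comp SlowSeq.continuous_toKothe) fun y => ?_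
  exact (seminorm_tmul_eq w x y).le

end MatrixSpace

/-- The map `s ⊗_ι s' → MatrixSpace`. -/
def indToMatrix : IndTensor RapidSeq SlowSeq →L[ℂ] MatrixSpace where
  toLinearMap := (TensorProduct.lift MatrixSpace.tmul : RapidSeq ⊗[ℂ] SlowSeq →ₗ[ℂ] MatrixSpace)
  cont := by
    change @Continuous (RapidSeq ⊗[ℂ] SlowSeq) _ (indTopology RapidSeq SlowSeq) _
      (TensorProduct.lift MatrixSpace.tmul)
    rw [continuous_iff_le_induced]
    exact sInf_le ⟨IsLCTopology.induced Kothe.withSeminorms.isLCTopology _,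
      fun x => continuous_induced_rng.2 (MatrixSpace.continuous_tmul_right x),
      fun y => continuous_induced_rng.2 (MatrixSpace.continuous_tmul_left y)⟩

theorem indToMatrix_tmul (x : RapidSeq) (y : SlowSeq) :
    indToMatrix (IndTensor.tmul x y) = MatrixSpace.tmul x y :=
  TensorProduct.lift.tmul (f' := MatrixSpace.tmul) x y

/-- The rows of an element of `s ⊗ s'`. -/
def indRow (i : ℕ+) : IndTensor RapidSeq SlowSeq →ₗ[ℂ] SlowSeq :=
  (TensorProduct.lift
    ((LinearMap.lsmul ℂ SlowSeq).comp ((LinearMap.proj i).comp RapidSeq.seq)) :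
      RapidSeq ⊗[ℂ] SlowSeq →ₗ[ℂ] SlowSeq)

theorem indRow_tmul (i : ℕ+) (x : RapidSeq) (y : SlowSeq) :
    indRow i (IndTensor.tmul x y) = x.seq i • y :=
  TensorProduct.lift.tmul (f' := (LinearMap.lsmul ℂ SlowSeq).comp
    ((LinearMap.proj i).comp RapidSeq.seq)) x y

theorem seq_indRow (i j : ℕ+) (t : IndTensor RapidSeq SlowSeq) :
    (indRow i t).seq j = (indToMatrix t).val (i, j) := by
  induction t using IndTensor.induction_on with
  | zero => simp
  | tmul x y => rw [indRow_tmul, indToMatrix_tmul, map_smul]; rfl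
  | add t u ht hu => simp [ht, hu]

/-- The rows of an algebraic tensor lie in `s'`, and continuity of `· ⊗ y` alone gives the
expansion. -/
theorem hasSum_indTensor (t : IndTensor RapidSeq SlowSeq) :
    HasSum (fun i => IndTensor.tmul (RapidSeq.unit i) (indRow i t)) t := by
  induction t using IndTensor.induction_on with
  | zero => simp [hasSum_zero]
  | tmul x y =>
    convert x.hasSum_unit.map (IndTensor.tmul.flip y : RapidSeq →ₗ[ℂ] IndTensor RapidSeq SlowSeq)
      (IndTensor.continuous_tmul_left y) using 2
    · rw [indRow_tmul, map_smul, Function.comp_apply, map_smul]; rfl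
    · rfl
  | add t u ht hu => simpa only [map_add] using ht.add hu

/-- The values of a continuous seminorm on the unit matrices form a matrix weight. -/
theorem exists_matrixWeight_of_seminorm {q : Seminorm ℂ (IndTensor RapidSeq SlowSeq)}
    (hq : Continuous q) : ∃ w : MatrixWeight, ∀ i j,
      (w.1 (i, j) : ℝ) = q (IndTensor.tmul (RapidSeq.unit i) (SlowSeq.unit j)) := by
  refine ⟨⟨fun a => ⟨q (IndTensor.tmul (RapidSeq.unit a.1) (SlowSeq.unit a.2)),
    apply_nonneg _ _⟩, fun k => ?_⟩, fun i j => rfl⟩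
  -- For fixed `x`, continuity in the second factor bounds `q(x ⊗ e_j)` by `C v_j` with `v` rapidly
  -- decreasing, so these seminorms are pointwise bounded in `j`. Barrelledness of `s` makes the
  -- bound uniform, and at `e_i` it is a multiple of `i^r`.
  let p : ℕ+ → Seminorm ℂ RapidSeq := fun j =>
    (j : ℝ≥0) ^ k • q.comp (IndTensor.tmul.flip (SlowSeq.unit j))
  obtain ⟨q', hq', hle⟩ := RapidSeq.continuous_iSup (p := p)
    (fun j => Continuous.const_smul (hq.comp (IndTensor.continuous_tmul_left (SlowSeq.unit j)))
      ((j : ℝ≥0) ^ k))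
    (fun x => by
      obtain ⟨v, C, hC, h⟩ := SlowSeq.exists_seminorm_bound
        (q := q.comp (IndTensor.tmul x)) (hq.comp (IndTensor.continuous_tmul_right x))
      obtain ⟨D, hD⟩ := v.2 k
      refine ⟨C * D, ?_⟩
      rintro _ ⟨j, rfl⟩
      have hj : Kothe.seminorm (fun v : RapidWeight => v.1) ℂ v (SlowSeq.unit j).toKothe =
          v.1 j := by
        have : (SlowSeq.unit j).toKothe = Kothe.single j 1 := rfl
        rw [this, Kothe.seminorm_single, norm_one, mul_one]
      have h1 : q (IndTensor.tmul x (SlowSeq.unit j)) ≤ C * v.1 j := hj ▸ h (SlowSeq.unit j)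
      calc (p j) x = (j : ℝ) ^ k * q (IndTensor.tmul x (SlowSeq.unit j)) := by
            simp [p, NNReal.smul_def]
        _ ≤ (j : ℝ) ^ k * (C * v.1 j) := by gcongr
        _ = C * (v.1 j * (j : ℝ) ^ k) := by ring
        _ ≤ C * D := by gcongr; exact hD j)
  obtain ⟨r, C, hC, h⟩ := RapidSeq.exists_bound hq'
  refine ⟨r, C, fun i j => ?_⟩
  have h1 := (hle j (RapidSeq.unit i)).trans (h (RapidSeq.unit i))
  rw [RapidSeq.seminorm_unit] at h1
  refine le_trans (le_of_eq ?_) h1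
  rw [mul_comm]
  simp [p, NNReal.smul_def]; rfl

/-- As the tensor map is only separately continuous, `t` is expanded in two stages, into rows and
then each row into unit vectors: `q(t) ≤ ∑_i ∑_j |t_ij| q(e_i ⊗ e_j)`. -/
theorem isInducing_indToMatrix : IsInducing indToMatrix := by
  refine isInducing_of_forall_seminorm_le _ fun q hq => ?_
  obtain ⟨w, hw⟩ := exists_matrixWeight_of_seminorm hq
  refine ⟨_, Kothe.continuous_seminorm w, fun t => ?_⟩
  have hs := (indToMatrix t).summable w
  rw [Kothe.seminorm_apply, hs.tsum_prod]
  refine seminorm_le_tsum hq (hasSum_indTensor t) hs.prod fun i => ?_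
  refine seminorm_le_tsum (q := q.comp (IndTensor.tmul (RapidSeq.unit i)))
    (hq.comp (IndTensor.continuous_tmul_right _)) (SlowSeq.hasSum_unit (indRow i t))
    (hs.prod_factor i) fun j => ?_
  rw [map_smul_eq_mul, seq_indRow, hw, mul_comm]
  rfl

theorem denseRange_indToMatrix : DenseRange indToMatrix := by
  intro y
  refine mem_closure_of_tendsto (Kothe.hasSum_single y) (Eventually.of_forall fun s => ?_)
  refine ⟨∑ a ∈ s, y.val a • IndTensor.tmul (RapidSeq.unit a.1) (SlowSeq.unit a.2), ?_⟩
  rw [map_sum]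
  refine Finset.sum_congr rfl fun a _ => ?_
  rw [map_smul, indToMatrix_tmul, MatrixSpace.tmul_unit, ← map_smul, smul_eq_mul, mul_one]

/-- `s ⊗̂_ι s'` is the space of matrices `MatrixSpace`. -/
def completedIndEquiv : CompletedInd RapidSeq SlowSeq ≃L[ℂ] MatrixSpace :=
  completionEquiv indToMatrix isInducing_indToMatrix denseRange_indToMatrix

theorem completedIndEquiv_tmul (x : RapidSeq) (y : SlowSeq) :
    completedIndEquiv (CompletedInd.tmul x y) = MatrixSpace.tmul x y :=
  (completionEquiv_coe _ _ _ _).trans (indToMatrix_tmul x y)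

/-! ### Inductive limits over scales of sequence spaces -/

/-- A scale of normed sequence spaces `F k`, `k ∈ ℤ`, whose norms lie between the weighted
sup norm and the weighted `ℓ¹` norm of order `k`, along the inclusions `f`. -/
structure SequenceScale (F : ℤ → Type*) [∀ k, NormedAddCommGroup (F k)]
    [∀ k, NormedSpace ℂ (F k)] (f : ∀ k l, k ≤ l → F k →L[ℂ] F l) where
  /-- The underlying sequence. -/
  seq : ∀ k, F k →ₗ[ℂ] (ℕ+ → ℂ)
  seq_injective : ∀ k, Function.Injective (seq k)
  norm_seq_le : ∀ k y j, ‖seq k y j‖ ≤ ‖y‖ * (j : ℝ) ^ k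
  /-- The unit vectors. -/
  unit : ∀ k, ℕ+ → F k
  seq_unit : ∀ k j, seq k (unit k j) = Pi.single j 1
  norm_unit_le : ∀ k j, ‖unit k j‖ ≤ (j : ℝ) ^ (-k)
  seq_map : ∀ k l h y, seq l (f k l h y) = seq k y

theorem continuous_indLim_iff {ι : Type*} [Preorder ι] [DecidableEq ι] {G : ι → Type*}
    [∀ i, AddCommGroup (G i)] [∀ i, Module ℂ (G i)] [∀ i, TopologicalSpace (G i)]
    {f : ∀ i j, i ≤ j → G i →L[ℂ] G j} {H : Type*} [AddCommGroup H] [Module ℂ H]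
    [TopologicalSpace H] (hH : IsLCTopology H ‹TopologicalSpace H›) (u : IndLim G f →ₗ[ℂ] H) :
    Continuous u ↔ ∀ i, Continuous (u.comp (IndLim.of G f i)) := by
  refine ⟨fun h i => h.comp (continuous_sInf_rng.2 fun _ ht => ht.2 i), fun h => ?_⟩
  rw [continuous_iff_le_induced]
  exact sInf_le ⟨hH.induced u, fun i => continuous_induced_rng.2 (h i)⟩

namespace SequenceScale

variable {F : ℤ → Type*} [∀ k, NormedAddCommGroup (F k)] [∀ k, NormedSpace ℂ (F k)]
  {f : ∀ k l, k ≤ l → F k →L[ℂ] F l} (S : SequenceScale F f)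

theorem exists_summable_bound (w : MatrixWeight) (k : ℤ) :
    ∃ (r : ℕ) (C : ℝ), 0 ≤ C ∧ ∀ t : VecRapid (F k),
      (Summable fun a : ℕ+ × ℕ+ => (w.1 a : ℝ) * ‖S.seq k (t.val a.1) a.2‖) ∧
      ∑' a : ℕ+ × ℕ+, (w.1 a : ℝ) * ‖S.seq k (t.val a.1) a.2‖ ≤
        C * Kothe.seminorm powWeight (F k) r t := by
  -- A negative `k` may be replaced by 0, since `j ≥ 1`.
  obtain ⟨r, C, hC, h⟩ := MatrixSpace.exists_tsum_bound w k.toNat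
  refine ⟨r, C, hC, fun t => ?_⟩
  have hs := t.summable r
  rw [Kothe.seminorm_apply]
  simp only [coe_powWeight] at hs ⊢
  refine h (fun i => ‖t.val i‖) (fun a => ‖S.seq k (t.val a.1) a.2‖) (fun _ => norm_nonneg _)
    (fun i j => (S.norm_seq_le k _ j).trans ?_) hs
  rw [← zpow_natCast]
  gcongr
  · exact one_le_pnat_cast j
  · exact Int.self_le_toNat k

/-- The matrix of a rapidly decreasing sequence in a space of the scale, as a linear map. -/
def toMatrixLinear (k : ℤ) : VecRapid (F k) →ₗ[ℂ] MatrixSpace where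
  toFun t := Kothe.mk (fun a => S.seq k (t.val a.1) a.2) fun w =>
    ((S.exists_summable_bound w k).choose_spec.choose_spec.2 t).1
  map_add' t u := Kothe.val_injective (funext fun a => by simp)
  map_smul' c t := Kothe.val_injective (funext fun a => by simp)

/-- The matrix of a rapidly decreasing sequence in a space of the scale. -/
def toMatrix (k : ℤ) : VecRapid (F k) →L[ℂ] MatrixSpace where
  toLinearMap := S.toMatrixLinear k
  cont := by
    refine Kothe.withSeminorms.continuous_of_continuous_comp (S.toMatrixLinear k) fun w => ?_
    obtain ⟨r, C, hC, h⟩ := S.exists_summable_bound w k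
    lift C to ℝ≥0 using hC
    exact Seminorm.continuous_of_le (q := C • Kothe.seminorm powWeight (F k) r)
      (Continuous.const_smul (Kothe.continuous_seminorm r) C) fun t => (h t).2

@[simp] theorem val_toMatrix (k : ℤ) (t : VecRapid (F k)) (a : ℕ+ × ℕ+) :
    (S.toMatrix k t).val a = S.seq k (t.val a.1) a.2 := rfl

theorem toMatrix_injective (k : ℤ) : Function.Injective (S.toMatrix k) := by
  intro t u h
  refine Kothe.val_injective (funext fun i => S.seq_injective k (funext fun j => ?_))
  exact congrFun (congrArg Kothe.val h) (i, j)

theorem val_toMatrix_tmul (k : ℤ) (x : RapidSeq) (y : F k) (a : ℕ+ × ℕ+) :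
    (S.toMatrix k (VecRapid.tmul (F k) x y)).val a = x.seq a.1 * S.seq k y a.2 := by
  simp

theorem toMatrix_single_unit (k : ℤ) (i j : ℕ+) :
    S.toMatrix k (Kothe.single i (S.unit k j)) = Kothe.single (i, j) 1 := by
  rw [← VecRapid.tmul_unit, ← MatrixSpace.tmul_unit]
  refine Kothe.val_injective (funext fun a => ?_)
  rw [val_toMatrix_tmul, S.seq_unit]
  rfl

/-- The coordinates of a space of the scale are continuous. -/
def coord (k : ℤ) (j : ℕ+) : F k →L[ℂ] ℂ :=
  ((LinearMap.proj j).comp (S.seq k)).mkContinuous ((j : ℝ) ^ k) fun y => by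
    rw [mul_comm]; exact S.norm_seq_le k y j

theorem toMatrix_eq_of_hasSum {k : ℤ} {t : VecRapid (F k)} {x : MatrixSpace}
    (h : ∀ i, HasSum (fun j => x.val (i, j) • S.unit k j) (t.val i)) : S.toMatrix k t = x := by
  refine Kothe.val_injective (funext fun ⟨i, j⟩ => ?_)
  have h1 := (h i).mapL (S.coord k j)
  refine h1.unique ?_
  have h2 : ∀ j', S.coord k j (x.val (i, j') • S.unit k j') =
      if j' = j then x.val (i, j) else 0 := by
    intro j'
    change S.seq k (x.val (i, j') • S.unit k j') j = _
    rw [map_smul, S.seq_unit, Pi.smul_apply, Pi.single_apply, smul_eq_mul]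
    by_cases hj : j = j'
    · simp [hj]
    · simp [hj, Ne.symm hj]
  simp only [h2]
  exact hasSum_ite_eq j _

variable [∀ k, CompleteSpace (F k)]

/-- If `i^r |x_ij| ≤ C_r j^n`, then in the step `n + 2` the terms satisfy `i^r ‖x_ij e_j‖ ≤ C_r
j⁻²`, so the rows converge absolutely. Convergence in the norm of the step is recorded because unit
vectors need not span a dense subspace there, as in `ℓ^∞`. -/
theorem exists_hasSum_rows (x : MatrixSpace) : ∃ (k : ℤ) (t : VecRapid (F k)),
    ∀ i, HasSum (fun j => x.val (i, j) • S.unit k j) (t.val i) := by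
  obtain ⟨n, hn⟩ := x.exists_bound
  choose C hC using hn
  have hle : ∀ r (i j : ℕ+), (i : ℝ) ^ r * ‖x.val (i, j) • S.unit (n + 2 : ℕ) j‖ ≤
      C r * ((j : ℝ) ^ 2)⁻¹ := by
    intro r i j
    have hj := one_le_pnat_cast j
    rw [norm_smul]
    calc (i : ℝ) ^ r * (‖x.val (i, j)‖ * ‖S.unit (n + 2 : ℕ) j‖)
        ≤ (i : ℝ) ^ r * (‖x.val (i, j)‖ * (j : ℝ) ^ (-((n + 2 : ℕ) : ℤ))) := by
          gcongr; exact S.norm_unit_le _ j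
      _ = (i : ℝ) ^ r * ‖x.val (i, j)‖ * ((j : ℝ) ^ (n + 2))⁻¹ := by
          rw [zpow_neg, zpow_natCast, mul_assoc]
      _ ≤ C r * (j : ℝ) ^ n * ((j : ℝ) ^ (n + 2))⁻¹ :=
          mul_le_mul_of_nonneg_right (hC r i j) (by positivity)
      _ = _ := by rw [pow_add]; field_simp
  have hnorm : ∀ i : ℕ+, Summable fun j => ‖x.val (i, j) • S.unit (n + 2 : ℕ) j‖ := fun i =>
    .of_nonneg_of_le (fun _ => norm_nonneg _)
      (fun j => by simpa only [pow_zero, one_mul] using hle 0 i j) (summable_inv_sq.mul_left (C 0))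
  have hbound : ∀ r (i : ℕ+), (i : ℝ) ^ r * ‖∑' j, x.val (i, j) • S.unit (n + 2 : ℕ) j‖ ≤
      C r * ∑' j : ℕ+, ((j : ℝ) ^ 2)⁻¹ := by
    intro r i
    refine (mul_le_mul_of_nonneg_left (norm_tsum_le_tsum_norm (hnorm i)) (by positivity)).trans ?_
    rw [← tsum_mul_left, ← tsum_mul_left]
    exact ((hnorm i).mul_left _).tsum_le_tsum (hle r i) (summable_inv_sq.mul_left _)
  refine ⟨(n + 2 : ℕ), Kothe.mk (fun i => ∑' j, x.val (i, j) • S.unit (n + 2 : ℕ) j) fun r => ?_,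
    fun i => (hnorm i).of_norm.hasSum⟩
  simp only [coe_powWeight]
  exact (summable_pow_mul_of_bound (fun _ => norm_nonneg _) (hbound (r + 2))).1

/-- The map `s ⊗̂ F k → MatrixSpace`. -/
def stepToMatrix (k : ℤ) : CompletedProj RapidSeq (F k) →L[ℂ] MatrixSpace :=
  (S.toMatrix k).comp (completedProjEquiv (F k)).toContinuousLinearMap

theorem stepToMatrix_tmul (k : ℤ) (x : RapidSeq) (y : F k) (a : ℕ+ × ℕ+) :
    (S.stepToMatrix k (CompletedProj.tmul x y)).val a = x.seq a.1 * S.seq k y a.2 := by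
  change (S.toMatrix k (completedProjEquiv (F k) (CompletedProj.tmul x y))).val a = _
  rw [completedProjEquiv_tmul, val_toMatrix_tmul]

theorem stepToMatrix_lmap {k l : ℤ} (h : k ≤ l) (z : CompletedProj RapidSeq (F k)) :
    S.stepToMatrix l (CompletedProj.lmap RapidSeq (f k l h) z) = S.stepToMatrix k z := by
  refine UniformSpace.Completion.induction_on z (isClosed_eq
    ((S.stepToMatrix l).continuous.comp (CompletedProj.lmap RapidSeq (f k l h)).continuous)
    (S.stepToMatrix k).continuous) fun t => ?_
  induction t using ProjTensor.induction_on with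
  | zero => rw [UniformSpace.Completion.coe_zero, map_zero, map_zero, map_zero]
  | tmul x y =>
    have h1 : CompletedProj.lmap RapidSeq (f k l h) (CompletedProj.tmul x y) =
        CompletedProj.tmul x (f k l h y) :=
      ContinuousLinearMap.completion_apply_coe (ProjTensor.lmap RapidSeq (f k l h)) _
    refine Kothe.val_injective (funext fun a => ?_)
    refine (congrArg (fun z => (S.stepToMatrix l z).val a) h1).trans ?_
    rw [stepToMatrix_tmul, S.seq_map]
    exact (S.stepToMatrix_tmul k x y a).symm
  | add t u ht hu => rw [UniformSpace.Completion.coe_add, map_add, map_add, map_add, ht, hu]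

/-- The inductive limit `ind lim_k (s ⊗̂ F k)`. -/
abbrev Lim (_ : SequenceScale F f) : Type _ :=
  IndLim (fun k : ℤ => CompletedProj RapidSeq (F k))
    fun k l h => CompletedProj.lmap RapidSeq (f k l h)

/-- The canonical map from `s ⊗̂ F k` to the inductive limit. -/
abbrev of (k : ℤ) : CompletedProj RapidSeq (F k) →ₗ[ℂ] S.Lim :=
  IndLim.of (fun k : ℤ => CompletedProj RapidSeq (F k))
    (fun k l h => CompletedProj.lmap RapidSeq (f k l h)) k

/-- The canonical map `ind lim_k (s ⊗̂ F k) → MatrixSpace`. -/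
def limToMatrix : S.Lim →ₗ[ℂ] MatrixSpace :=
  Module.DirectLimit.lift ℂ ℤ (fun k : ℤ => CompletedProj RapidSeq (F k))
    (fun k l h => (CompletedProj.lmap RapidSeq (f k l h)).toLinearMap)
    (fun k => (S.stepToMatrix k).toLinearMap) fun _ _ h z => S.stepToMatrix_lmap h z

theorem limToMatrix_of (k : ℤ) (z : CompletedProj RapidSeq (F k)) :
    S.limToMatrix (S.of k z) = S.stepToMatrix k z :=
  Module.DirectLimit.lift_of (f := fun k l h => (CompletedProj.lmap RapidSeq (f k l h)).toLinearMap)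
    (fun k => (S.stepToMatrix k).toLinearMap) (fun _ _ h z => S.stepToMatrix_lmap h z) z

/-- Injectivity holds on each step, since an element is determined by its matrix, and passes to the
direct limit; surjectivity is `exists_hasSum_rows`. -/
theorem limToMatrix_bijective : Function.Bijective S.limToMatrix := by
  refine ⟨Module.DirectLimit.lift_injective _ _ fun k => ?_, fun x => ?_⟩
  · exact (S.toMatrix_injective k).comp (completedProjEquiv (F k)).injective
  · obtain ⟨k, t, ht⟩ := S.exists_hasSum_rows x
    refine ⟨S.of k ((completedProjEquiv (F k)).symm t), ?_⟩
    rw [limToMatrix_of]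
    change S.toMatrix k (completedProjEquiv (F k) ((completedProjEquiv (F k)).symm t)) = x
    rw [ContinuousLinearEquiv.apply_symm_apply, S.toMatrix_eq_of_hasSum ht]

/-- The algebraic isomorphism `ind lim_k (s ⊗̂ F k) ≃ MatrixSpace`. -/
def limLinearEquiv : S.Lim ≃ₗ[ℂ] MatrixSpace :=
  LinearEquiv.ofBijective S.limToMatrix S.limToMatrix_bijective

theorem continuous_limLinearEquiv : Continuous S.limLinearEquiv :=
  (continuous_indLim_iff Kothe.withSeminorms.isLCTopology S.limToMatrix).2 fun k =>
    (S.stepToMatrix k).continuous.congr fun z => (S.limToMatrix_of k z).symm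

theorem limLinearEquiv_symm_toMatrix (k : ℤ) (t : VecRapid (F k)) :
    S.limLinearEquiv.symm (S.toMatrix k t) = S.of k ((completedProjEquiv (F k)).symm t) := by
  rw [LinearEquiv.symm_apply_eq]
  refine Eq.symm ((S.limToMatrix_of k _).trans ?_)
  change S.toMatrix k (completedProjEquiv (F k) ((completedProjEquiv (F k)).symm t)) = _
  rw [ContinuousLinearEquiv.apply_symm_apply]

/-- A continuous seminorm on the limit, transported to matrices, is bounded by the weighted sum
formed with its own values at the unit matrices. -/
theorem continuous_limLinearEquiv_symm : Continuous S.limLinearEquiv.symm := by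
  have hLC : IsLCTopology S.Lim inferInstance := isLCTopology_finestLC S.Lim _
  have := hLC.polynormableSpace
  refine continuous_of_forall_seminorm_le S.limLinearEquiv.symm.toLinearMap fun q hq => ?_
  let p : Seminorm ℂ MatrixSpace := q.comp S.limLinearEquiv.symm.toLinearMap
  have hp : ∀ k, Continuous (p.comp (S.toMatrix k).toLinearMap) := by
    intro k
    have hof : Continuous (S.of k) := continuous_sInf_rng.2 fun _ ht => ht.2 k
    refine (hq.comp (hof.comp (completedProjEquiv (F k)).symm.continuous)).congr fun t => ?_
    exact congrArg q (S.limLinearEquiv_symm_toMatrix k t).symm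
  -- The decay of order `n` in `j` comes from continuity of `p` on the step `n`, where `‖e_j‖ ≤
  -- j^{-n}`.
  let w : MatrixWeight := ⟨fun a => ⟨p (Kothe.single a 1), apply_nonneg _ _⟩, fun n => by
    obtain ⟨r, C, hC, h⟩ := VecRapid.exists_bound (hp n)
    refine ⟨r, C, fun i j => ?_⟩
    have hj := one_le_pnat_cast j
    have h1 := h (Kothe.single i (S.unit n j))
    rw [Kothe.seminorm_single, coe_powWeight] at h1
    have h2 : p (Kothe.single (i, j) 1) ≤ C * ((i : ℝ) ^ r * (j : ℝ) ^ (-(n : ℤ))) := by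
      rw [← S.toMatrix_single_unit n i j]
      refine h1.trans ?_
      gcongr
      exact S.norm_unit_le n j
    rw [zpow_neg, zpow_natCast, ← mul_assoc, ← div_eq_mul_inv,
      le_div_iff₀ (by positivity)] at h2
    exact h2⟩
  refine ⟨_, Kothe.continuous_seminorm w, fun x => ?_⟩
  -- Continuity of `p` is so far known only on the steps, so `x` is expanded inside a step where its
  -- rows converge.
  obtain ⟨k, t, ht⟩ := S.exists_hasSum_rows x
  have hs := x.summable w
  rw [Kothe.seminorm_apply, hs.tsum_prod]
  change p x ≤ _
  rw [← S.toMatrix_eq_of_hasSum ht]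
  refine seminorm_le_tsum (hp k) (Kothe.hasSum_single t) ?_ fun i => ?_
  · rw [S.toMatrix_eq_of_hasSum ht]
    exact hs.prod
  rw [S.toMatrix_eq_of_hasSum ht]
  have hc : Continuous (Kothe.single i : F k →ₗ[ℂ] VecRapid (F k)) :=
    (VecRapid.continuous_tmul.comp (continuous_const.prodMk continuous_id)).congr
      (VecRapid.tmul_unit i)
  refine seminorm_le_tsum (q := (p.comp (S.toMatrix k).toLinearMap).comp (Kothe.single i))
    ((hp k).comp hc) (ht i) (hs.prod_factor i) fun j => ?_
  rw [map_smul_eq_mul, mul_comm]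
  refine le_of_eq (congrArg (· * ‖x.val (i, j)‖) ?_)
  exact congrArg p (S.toMatrix_single_unit k i j)

/-- `ind lim_k (s ⊗̂ F k)` is the space of matrices `MatrixSpace`. -/
def limEquiv : S.Lim ≃L[ℂ] MatrixSpace where
  toLinearEquiv := S.limLinearEquiv
  continuous_toFun := S.continuous_limLinearEquiv
  continuous_invFun := S.continuous_limLinearEquiv_symm

theorem val_limEquiv_tmul (k : ℤ) (x : RapidSeq) (y : F k) (a : ℕ+ × ℕ+) :
    (S.limEquiv (S.of k (CompletedProj.tmul x y))).val a = x.seq a.1 * S.seq k y a.2 :=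
  (congrArg (fun z => Kothe.val z a) (S.limToMatrix_of k _)).trans (S.stepToMatrix_tmul k x y a)

end SequenceScale

/-! ### The scales `(ℓ^p)_{-k}` and `(c_0)_{-k}` -/

section Scales

theorem pnat_zpow_mul_cancel (j : ℕ+) (k : ℤ) (z : ℂ) : (j : ℂ) ^ k * ((j : ℂ) ^ (-k) * z) = z := by
  have hj : (j : ℂ) ≠ 0 := by exact_mod_cast j.ne_zero
  rw [← mul_assoc, ← zpow_add₀ hj, add_neg_cancel, zpow_zero, one_mul]

variable (p : ℝ≥0∞) (k : ℤ)

theorem WLp.toLp_surjective : Function.Surjective (WLp.toLp (p := p) (k := k)) := by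
  intro z
  have hz : ∀ j : ℕ+, (j : ℂ) ^ (-k) * ((j : ℂ) ^ k * z j) = z j := fun j => by
    simpa using pnat_zpow_mul_cancel j (-k) (z j)
  refine ⟨⟨fun j => (j : ℂ) ^ k * z j, ?_⟩, Subtype.ext (funext hz)⟩
  change Memℓp (fun j : ℕ+ => (j : ℂ) ^ (-k) * ((j : ℂ) ^ k * z j)) p
  rw [funext hz]
  exact z.2

variable {p k} in
theorem WLp.seq_mk (z : ℕ+ → ℂ) (hz : z ∈ wlpSubmodule p k) :
    WLp.seq (p := p) (k := k) (⟨z, hz⟩ : wlpSubmodule p k) = z := rfl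

variable [Fact (1 ≤ p)]

instance : CompleteSpace (WLp p k) := by
  let e : WLp p k ≃ₗᵢ[ℂ] lp (fun _ : ℕ+ => ℂ) p :=
    ⟨LinearEquiv.ofBijective WLp.toLp ⟨WLp.toLp_injective, WLp.toLp_surjective p k⟩, fun _ => rfl⟩
  exact (completeSpace_congr (e := e.toEquiv) e.isometry.isUniformEmbedding).2 inferInstance

variable {p k}

theorem WLp.norm_seq_le (y : WLp p k) (j : ℕ+) : ‖y.seq j‖ ≤ ‖y‖ * (j : ℝ) ^ k := by
  have h : ‖(j : ℂ) ^ (-k) * y.seq j‖ ≤ ‖y‖ :=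
    lp.norm_apply_le_norm (zero_lt_one.trans_le (Fact.out : 1 ≤ p)).ne' y.toLp j
  calc ‖y.seq j‖ = (j : ℝ) ^ k * ‖(j : ℂ) ^ (-k) * y.seq j‖ := by
        conv_lhs => rw [← pnat_zpow_mul_cancel j k (y.seq j), norm_mul, norm_zpow,
          Complex.norm_natCast]
    _ ≤ (j : ℝ) ^ k * ‖y‖ := by gcongr
    _ = _ := mul_comm _ _

theorem WLp.exists_unit (p : ℝ≥0∞) [Fact (1 ≤ p)] (k : ℤ) (j : ℕ+) :
    ∃ y : WLp p k, y.seq = Pi.single j 1 ∧ ‖y‖ = (j : ℝ) ^ (-k) := by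
  obtain ⟨y, hy⟩ := WLp.toLp_surjective p k (lp.single p j ((j : ℂ) ^ (-k)))
  refine ⟨y, funext fun i => ?_, ?_⟩
  · have h : (i : ℂ) ^ (-k) * y.seq i = Pi.single (M := fun _ => ℂ) j ((j : ℂ) ^ (-k)) i :=
      congrFun (congrArg Subtype.val hy) i
    rw [← pnat_zpow_mul_cancel i k (y.seq i), h]
    rcases eq_or_ne i j with rfl | hij
    · have := pnat_zpow_mul_cancel i k 1
      simpa using this
    · simp [hij]
  · rw [WLp.norm_def, hy, lp.norm_single (zero_lt_one.trans_le (Fact.out : 1 ≤ p)), norm_zpow,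
      Complex.norm_natCast]

theorem WLp.seq_incl {k l : ℤ} (h : k ≤ l) (y : WLp p k) : (WLp.incl p h y).seq = y.seq :=
  (congrArg WLp.seq (LinearMap.mkContinuous_apply (WLp.inclLinear p h) 1
    (WLp.norm_inclLinear_le h) y)).trans (WLp.seq_mk _ _)

theorem WC0.seq_incl {k l : ℤ} (h : k ≤ l) (y : WC0 k) : (WC0.incl h y).1.seq = y.1.seq :=
  WLp.seq_incl h y.1

/-- The scale `(ℓ^p)_{-k}`. -/
def wlpScale (p : ℝ≥0∞) [Fact (1 ≤ p)] :
    SequenceScale (fun k : ℤ => WLp p k) fun _ _ h => WLp.incl p h where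
  seq _ := WLp.seq
  seq_injective _ := Subtype.val_injective
  norm_seq_le _ y j := y.norm_seq_le j
  unit k j := (WLp.exists_unit p k j).choose
  seq_unit k j := (WLp.exists_unit p k j).choose_spec.1
  norm_unit_le k j := (WLp.exists_unit p k j).choose_spec.2.le
  seq_map _ _ h y := WLp.seq_incl h y

/-- Null sequences are stable under uniform limits; closedness supplies the completeness needed for
`completedProjEquiv`. -/
theorem WC0.isClosed (k : ℤ) : IsClosed (WC0 k : Set (WLp ∞ k)) := by
  refine isClosed_of_closure_subset fun x hx => ?_
  refine Metric.tendsto_nhds.2 fun ε hε => ?_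
  obtain ⟨y, hy, hxy⟩ := Metric.mem_closure_iff.1 hx (ε / 2) (half_pos hε)
  have hy' : Tendsto (fun j : ℕ+ => (j : ℂ) ^ (-k) * y.seq j) atTop (𝓝 0) := hy
  filter_upwards [Metric.tendsto_nhds.1 hy' (ε / 2) (half_pos hε)] with j hj
  rw [dist_zero_right] at hj ⊢
  have h : ‖(j : ℂ) ^ (-k) * (x - y).seq j‖ ≤ ‖x - y‖ :=
    lp.norm_apply_le_norm ENNReal.top_ne_zero (x - y).toLp j
  rw [dist_eq_norm] at hxy
  have h2 : (j : ℂ) ^ (-k) * x.seq j =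
      (j : ℂ) ^ (-k) * (x - y).seq j + (j : ℂ) ^ (-k) * y.seq j := by
    rw [map_sub, Pi.sub_apply]; ring
  rw [h2]
  linarith [norm_add_le ((j : ℂ) ^ (-k) * (x - y).seq j) ((j : ℂ) ^ (-k) * y.seq j)]

instance (k : ℤ) : CompleteSpace (WC0 k) := (WC0.isClosed k).completeSpace_coe

theorem WC0.exists_unit (k : ℤ) (j : ℕ+) :
    ∃ y : WC0 k, y.1.seq = Pi.single j 1 ∧ ‖y‖ = (j : ℝ) ^ (-k) := by
  obtain ⟨y, hy, hn⟩ := WLp.exists_unit ∞ k j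
  refine ⟨⟨y, ?_⟩, hy, hn⟩
  change Tendsto (fun i : ℕ+ => (i : ℂ) ^ (-k) * y.seq i) atTop (𝓝 0)
  refine tendsto_const_nhds.congr' ?_
  filter_upwards [eventually_gt_atTop j] with i hi
  rw [hy, Pi.single_eq_of_ne hi.ne', mul_zero]

/-- The scale `(c_0)_{-k}`. -/
def wc0Scale : SequenceScale (fun k : ℤ => WC0 k) fun _ _ h => WC0.incl h where
  seq k := WLp.seq.comp (WC0 k).subtype
  seq_injective _ := Subtype.val_injective.comp Subtype.val_injective
  norm_seq_le _ y j := y.1.norm_seq_le j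
  unit k j := (WC0.exists_unit k j).choose
  seq_unit k j := (WC0.exists_unit k j).choose_spec.1
  norm_unit_le k j := (WC0.exists_unit k j).choose_spec.2.le
  seq_map _ _ h y := WC0.seq_incl h y

theorem val_limEquiv_limLp_tmul (x : RapidSeq) (y : WLp p k) (a : ℕ+ × ℕ+) :
    ((wlpScale p).limEquiv (LimLp.tmul x y)).val a = x.seq a.1 * y.seq a.2 :=
  (wlpScale p).val_limEquiv_tmul k x y a

theorem val_limEquiv_limC0_tmul (x : RapidSeq) (y : WC0 k) (a : ℕ+ × ℕ+) :
    (wc0Scale.limEquiv (LimC0.tmul x y)).val a = x.seq a.1 * y.1.seq a.2 :=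
  wc0Scale.val_limEquiv_tmul k x y a

end Scales

end SeqTensor

end

theorem corollary2p4 (p : ℝ≥0∞) [Fact (1 ≤ p)] :
    (∃ T : SeqTensor.CompletedInd SeqTensor.RapidSeq SeqTensor.SlowSeq ≃L[ℂ] SeqTensor.LimLp p,
      ∀ (x : SeqTensor.RapidSeq) (y : SeqTensor.SlowSeq) (k : ℤ) (y' : SeqTensor.WLp p k),
        y'.seq = y.seq →
          T (SeqTensor.CompletedInd.tmul x y) = SeqTensor.LimLp.tmul x y') ∧
    (∃ U : SeqTensor.LimLp p ≃L[ℂ] SeqTensor.LimC0,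
      ∀ (x : SeqTensor.RapidSeq) (k l : ℤ) (y : SeqTensor.WLp p k) (y' : SeqTensor.WC0 l),
        y'.1.seq = y.seq →
          U (SeqTensor.LimLp.tmul x y) = SeqTensor.LimC0.tmul x y') := by
  -- Both isomorphisms pass through `MatrixSpace`; the formulas on elementary tensors hold because
  -- both sides have the entries `x_i y_j`.
  refine ⟨⟨SeqTensor.completedIndEquiv.trans (SeqTensor.wlpScale p).limEquiv.symm,
    fun x y k y' h => ?_⟩, ⟨(SeqTensor.wlpScale p).limEquiv.trans
      SeqTensor.wc0Scale.limEquiv.symm, fun x k l y y' h => ?_⟩⟩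
  · rw [ContinuousLinearEquiv.trans_apply, ContinuousLinearEquiv.symm_apply_eq,
      SeqTensor.completedIndEquiv_tmul]
    refine SeqTensor.Kothe.val_injective (funext fun a => ?_)
    rw [SeqTensor.val_limEquiv_limLp_tmul, SeqTensor.MatrixSpace.val_tmul, h]
  · rw [ContinuousLinearEquiv.trans_apply, ContinuousLinearEquiv.symm_apply_eq]
    refine SeqTensor.Kothe.val_injective (funext fun a => ?_)
    rw [SeqTensor.val_limEquiv_limLp_tmul, SeqTensor.val_limEquiv_limC0_tmul, h]
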